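/- Let $\mathbb T^2=(\mathbb R/2\pi\mathbb Z)^2\cong[-\pi,\pi)^2$ with Lebesgue measure, let $|x|$ denote the distance of $x\in\mathbb T^2$ to $0$ in the flat metric, let $\langle r\rangle=(1+r^2)^{1/2}$, and for functions on $\mathbb T^2$ write $(f*_xg)(x)=\frac1{2\pi}\int_{\mathbb T^2}f(x-y)g(y)\,dy$. Fix $\chi\in C_c^\infty(\mathbb R;\mathbb R)$ with $\chi=1$ on $[-\frac34,\frac34]$ and $\operatorname{supp}\chi\subset[-1,1]$. Let $$\mathcal W_{\mathbb R^2}(t,x)=\frac{\mathbf 1_{\{|x|<|t|\}}}{\sqrt{t^2-|x|^2}},\qquad \mathcal W_{\mathbb T^2}(t,x)=\sum_{m\in\mathbb Z^2}\mathcal W_{\mathbb R^2}(t,x+2\pi m),$$ $$K^\star(t,s,x)=e^{-\frac12(t-s)}\chi(t)\,\mathbf 1_{[s,\infty)}(t)\,\mathbf 1_{[0,\infty)}(s)\,\mathcal W_{\mathbb T^2}(t-s,x),$$ and define the time-localized damped-wave Duhamel operator $$\mathcal I^\star_{\rm wave}(F)(t)=\int_{\mathbb R}K^\star(t,s,\cdot)*_xF(s)\,ds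 .$$ For $0\le\sigma<\frac12$ let $\mathcal A_\sigma(F)(t)=\int_{\mathbb R}\mathcal R_\sigma(t,s,\cdot)*_x|F(s)|\,ds\in[0,\infty]$, where $$\mathcal R_\sigma(t,s,x)=\langle t\rangle^{-3-\sigma}\Big(1+|t-s|^{-\frac12-\sigma}|x|^{-\frac12}+(|t-s|+|x|)^{-\frac12}\big||t-s|-|x|\big|^{-\frac12-\sigma}\Big)\Big\langle\log\big||t-s|-|x|\big|\Big\rangle^2\langle\log|x|\rangle^3 .$$ Let $(-\Delta_{\mathbb R\times\mathbb T^2})^{\sigma/2}$ be the Fourier multiplier with symbol $(\tau^2+|n|^2)^{\sigma/2}$, $(\tau,n)\in\mathbb R\times\mathbb Z^2$ (the identity if $\sigma=0$). **Proposition.** Let $1\le p<\infty$ and $0\le\sigma<\frac12$. There is a constant $C<\infty$, depending only on $p$, $\sigma$ and $\chi$, such that for every measurable $F:\mathbb R\times\mathbb T^2\to\mathbb C$ with $\|\mathcal A_\sigma(F)\|_{L^p(\mathbb R\times\mathbb T^2)}<\infty$ the integral defining $\mathcal I^\star_{\rm wave}(F)(t,x)$ converges absolutely for almost every $(t,x)$,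 the functions $\mathcal I^\star_{\rm wave}(F)$ and $(-\Delta_{\mathbb R\times\mathbb T^2})^{\sigma/2}\mathcal I^\star_{\rm wave}(F)$ belong to $L^1(\mathbb R\times\mathbb T^2)$, and $$\big\|(-\Delta_{\mathbb R\times\mathbb T^2})^{\frac\sigma2}\mathcal I^\star_{\rm wave}(F)\big\|_{L^p(\mathbb R\times\mathbb T^2)}\le C\,\big\|\mathcal A_\sigma(F)\big\|_{L^p(\mathbb R\times\mathbb T^2)} .$$ -/

import Mathlib

open MeasureTheory Real
open scoped ENNReal NNReal ContDiff

noncomputable section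

/-- The length `2π` of the circle is positive. -/
instance fact_two_pi_pos : Fact (0 < 2 * π) := ⟨Real.two_pi_pos⟩

/-- The torus `𝕋² = (ℝ / 2πℤ)²`. Its measure `volume` has total mass `(2π)²`. -/
abbrev Torus2 : Type := AddCircle (2 * π) × AddCircle (2 * π)

/-- `|x|` for `x ∈ 𝕋²`: the distance to `0` in the flat metric, i.e. the minimum of the Euclidean
norm over all representatives of `x` in `ℝ²` (`‖·‖` on the circle is the distance to `0`). -/
def torusAbs (x : Torus2) : ℝ := √(‖x.1‖ ^ 2 + ‖x.2‖ ^ 2)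

/-- The representative of a point of `𝕋²` in `[-π, π)²`. -/
def torusRep (x : Torus2) : ℝ × ℝ :=
  (AddCircle.equivIco (2 * π) (-π) x.1, AddCircle.equivIco (2 * π) (-π) x.2)

/-- The Japanese bracket `⟨r⟩ = (1 + r²)^{1/2}`. -/
def japBracket (r : ℝ) : ℝ := √(1 + r ^ 2)

/-- The wave kernel on `ℝ²`: `W(t, x) = 1_{|x| < |t|} (t² - |x|²)^{-1/2}`. -/
def planeWaveKernel (t : ℝ) (x : ℝ × ℝ) : ℝ :=
  if √(x.1 ^ 2 + x.2 ^ 2) < |t| then 1 / √(t ^ 2 - (x.1 ^ 2 + x.2 ^ 2)) else 0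

/-- The wave kernel on `𝕋²`: the periodization `∑_{m ∈ ℤ²} W(t, x + 2πm)`. For each `(t, x)` only
finitely many terms are nonzero. -/
def torusWaveKernel (t : ℝ) (x : Torus2) : ℝ :=
  ∑' m : ℤ × ℤ, planeWaveKernel t
    ((torusRep x).1 + 2 * π * (m.1 : ℝ), (torusRep x).2 + 2 * π * (m.2 : ℝ))

/-- The time-localized damped wave kernel
`K⋆(t, s, x) = e^{-(t-s)/2} χ(t) 1_{[s,∞)}(t) 1_{[0,∞)}(s) W_{𝕋²}(t - s, x)`. -/
def dampedWaveKernel (χ : ℝ → ℝ) (t s : ℝ) (x : Torus2) : ℝ :=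
  Real.exp (-(1 / 2) * (t - s)) * χ t * (Set.Ici s).indicator (fun _ => (1 : ℝ)) t
    * (Set.Ici (0 : ℝ)).indicator (fun _ => (1 : ℝ)) s * torusWaveKernel (t - s) x

/-- The Duhamel operator
`I⋆(F)(t, x) = ∫_ℝ (K⋆(t, s, ·) *ₓ F(s))(x) ds`, `(f *ₓ g)(x) = (2π)⁻¹ ∫_{𝕋²} f(x - y) g(y) dy`. -/
def dampedWaveDuhamel (χ : ℝ → ℝ) (F : ℝ × Torus2 → ℂ) (z : ℝ × Torus2) : ℂ :=
  ∫ s : ℝ, ((2 * π)⁻¹ : ℂ) * ∫ y : Torus2, (dampedWaveKernel χ z.1 s (z.2 - y) : ℂ) * F (s, y)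

/-- The kernel `R_σ(t, s, x)`. -/
def majorantKernel (σ t s : ℝ) (x : Torus2) : ℝ :=
  japBracket t ^ (-3 - σ)
    * (1 + |t - s| ^ (-(1 / 2) - σ) * torusAbs x ^ (-(1 / 2) : ℝ)
      + (|t - s| + torusAbs x) ^ (-(1 / 2) : ℝ) * |(|t - s| - torusAbs x)| ^ (-(1 / 2) - σ))
    * japBracket (Real.log |(|t - s| - torusAbs x)|) ^ 2
    * japBracket (Real.log (torusAbs x)) ^ 3

/-- The sublinear operator `A_σ(F)(t, x) = ∫_ℝ (R_σ(t, s, ·) *ₓ |F(s)|)(x) ds`, with values in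
`[0, ∞]`; the convolution is normalized as in `dampedWaveDuhamel`. -/
def majorantOperator (σ : ℝ) (F : ℝ × Torus2 → ℂ) (z : ℝ × Torus2) : ℝ≥0∞ :=
  ∫⁻ s : ℝ, ENNReal.ofReal (2 * π)⁻¹
    * ∫⁻ y : Torus2, ENNReal.ofReal (majorantKernel σ z.1 s (z.2 - y)) * ‖F (s, y)‖ₑ

/-- The space-time Fourier transform `∫_{ℝ × 𝕋²} u(t, x) e^{-i(τt + n·x)} dt dx` of an integrable
function on `ℝ × 𝕋²`, at `τ ∈ ℝ` and `n ∈ ℤ²` (`fourier k` is the character `e^{ikx}`). -/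
def spaceTimeFourier (u : ℝ × Torus2 → ℂ) (τ : ℝ) (n : ℤ × ℤ) : ℂ :=
  ∫ z : ℝ × Torus2, Complex.exp (-(Complex.I * ((τ * z.1 : ℝ) : ℂ)))
    * fourier (-n.1) z.2.1 * fourier (-n.2) z.2.2 * u z

/-- `g = (-Δ_{ℝ×𝕋²})^{σ/2} G` for integrable functions `G` and `g`: the fractional Laplacian is the
Fourier multiplier with symbol `(τ² + |n|²)^{σ/2}` (the constant `1` if `σ = 0`). By uniqueness of
Fourier transforms, `g` is determined by `G` up to a null set. -/
structure IsFracLaplacian (σ : ℝ) (G g : ℝ × Torus2 → ℂ) : Prop where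
  integrable_left : Integrable G volume
  integrable_right : Integrable g volume
  fourier_eq : ∀ (τ : ℝ) (n : ℤ × ℤ),
    spaceTimeFourier g τ n
      = (((τ ^ 2 + ((n.1 : ℝ) ^ 2 + (n.2 : ℝ) ^ 2)) ^ (σ / 2) : ℝ) : ℂ) * spaceTimeFourier G τ n

end

/-! ### The distance to the origin on the torus -/

theorem torusAbs_nonneg (x : Torus2) : 0 ≤ torusAbs x := Real.sqrt_nonneg _

theorem continuous_torusAbs : Continuous torusAbs := by
  unfold torusAbs; fun_prop

theorem norm_fst_le_torusAbs (x : Torus2) : ‖x.1‖ ≤ torusAbs x :=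
  Real.le_sqrt_of_sq_le (by nlinarith [sq_nonneg ‖x.2‖])

theorem norm_snd_le_torusAbs (x : Torus2) : ‖x.2‖ ≤ torusAbs x :=
  Real.le_sqrt_of_sq_le (by nlinarith [sq_nonneg ‖x.1‖])

theorem abs_torusAbs_sub_le (x y : Torus2) :
    |torusAbs x - torusAbs y| ≤ ‖x.1 - y.1‖ + ‖x.2 - y.2‖ := by
  have key : ∀ z : Torus2, torusAbs z = ‖(⟨‖z.1‖, ‖z.2‖⟩ : ℂ)‖ := fun z => by
    rw [Complex.norm_def, Complex.normSq_apply, torusAbs]; congr 1; ring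
  rw [key, key]
  refine (abs_norm_sub_norm_le _ _).trans ((Complex.norm_le_abs_re_add_abs_im _).trans ?_)
  exact add_le_add (abs_norm_sub_norm_le _ _) (abs_norm_sub_norm_le _ _)

theorem norm_coe_addCircle_le (v : ℝ) : ‖(v : AddCircle (2 * π))‖ ≤ |v| :=
  QuotientAddGroup.norm_mk_le_norm

/-! ### The wave kernel on short time intervals -/

/-- The wave kernel on `ℝ²` as a function of time and of the distance `r` to the origin. -/
noncomputable def coneProfile (u r : ℝ) : ℝ := if r < u then 1 / √(u ^ 2 - r ^ 2) else 0

theorem coneProfile_nonneg (u r : ℝ) : 0 ≤ coneProfile u r := by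
  unfold coneProfile; split_ifs <;> positivity

theorem coneProfile_of_le {u r : ℝ} (h : u ≤ r) : coneProfile u r = 0 := if_neg h.not_gt

theorem measurable_coneProfile : Measurable fun q : ℝ × ℝ => coneProfile q.1 q.2 := by
  unfold coneProfile
  exact Measurable.ite (measurableSet_lt measurable_snd measurable_fst) (by fun_prop)
    measurable_const

theorem torusAbs_eq_torusRep (x : Torus2) :
    torusAbs x = √((torusRep x).1 ^ 2 + (torusRep x).2 ^ 2) := by
  have key : ∀ a : AddCircle (2 * π), ‖a‖ ^ 2 = (AddCircle.equivIco (2 * π) (-π) a : ℝ) ^ 2 := by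
    intro a
    set v := AddCircle.equivIco (2 * π) (-π) a with hv
    have h1 : ((v : ℝ) : AddCircle (2 * π)) = a := (AddCircle.equivIco (2 * π) (-π)).symm_apply_apply a
    have h2 := v.2
    rw [← h1, (AddCircle.norm_coe_eq_abs_iff (2 * π) (by positivity)).2, sq_abs]
    rw [abs_of_pos Real.two_pi_pos, abs_le]
    constructor <;> linarith [h2.1, h2.2]
  rw [torusAbs, key, key, torusRep]

theorem torusWaveKernel_eq_coneProfile {u : ℝ} (hu0 : 0 ≤ u) (hu : u ≤ 1) (x : Torus2) :
    torusWaveKernel u x = coneProfile u (torusAbs x) := by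
  have hmem : ∀ a : AddCircle (2 * π), ∀ m : ℤ, m ≠ 0 →
      1 ≤ ((AddCircle.equivIco (2 * π) (-π) a : ℝ) + 2 * π * (m : ℝ)) ^ 2 := by
    intro a m hm
    have h2 := (AddCircle.equivIco (2 * π) (-π) a).2
    have hpi := Real.pi_gt_three
    obtain ⟨h2a, h2b⟩ := h2
    rcases lt_or_gt_of_ne hm with h | h
    · have : (m : ℝ) ≤ -1 := by exact_mod_cast Int.le_sub_one_of_lt h
      have h3 : 2 * π * (m : ℝ) ≤ 2 * π * (-1) := by gcongr
      nlinarith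
    · have : (1 : ℝ) ≤ m := by exact_mod_cast h
      have h3 : 2 * π * 1 ≤ 2 * π * (m : ℝ) := by gcongr
      nlinarith
  rw [torusWaveKernel, tsum_eq_single (0, 0)]
  · simp only [planeWaveKernel, coneProfile, Int.cast_zero, mul_zero, add_zero,
      ← torusAbs_eq_torusRep, abs_of_nonneg hu0]
    rw [torusAbs_eq_torusRep x, Real.sq_sqrt (by positivity)]
  · rintro ⟨m, n⟩ hmn
    rw [planeWaveKernel, if_neg]
    rw [abs_of_nonneg hu0, not_lt]
    refine hu.trans (Real.le_sqrt_of_sq_le ?_)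
    simp only [ne_eq, Prod.mk.injEq, not_and_or] at hmn
    rw [one_pow]
    rcases hmn with h | h
    · exact (hmem x.1 m h).trans (le_add_of_nonneg_right (sq_nonneg _))
    · exact (hmem x.2 n h).trans (le_add_of_nonneg_left (sq_nonneg _))

/-- The time localization of `dampedWaveKernel` in the outer variable. -/
noncomputable def outerCutoff (χ : ℝ → ℝ) (t : ℝ) : ℝ := Real.exp (-(1 / 2) * t) * χ t

/-- The time localization of `dampedWaveKernel` in the inner variable. -/
noncomputable def innerCutoff (s : ℝ) : ℝ :=
  (Set.Icc (0 : ℝ) 1).indicator (fun s => Real.exp (1 / 2 * s)) s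

theorem innerCutoff_nonneg (s : ℝ) : 0 ≤ innerCutoff s :=
  Set.indicator_nonneg (fun _ _ => (Real.exp_pos _).le) _

theorem innerCutoff_le_two (s : ℝ) : innerCutoff s ≤ 2 := by
  unfold innerCutoff
  by_cases hs : s ∈ Set.Icc (0 : ℝ) 1
  swap
  · rw [Set.indicator_of_notMem hs]; norm_num
  rw [Set.indicator_of_mem hs]
  have h1 : Real.exp (1 / 2 * s) ≤ Real.exp (1 / 2) := Real.exp_le_exp.2 (by linarith [hs.2])
  have h2 : Real.exp (1 / 2) ^ 2 = Real.exp 1 := by rw [← Real.exp_nat_mul]; norm_num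
  nlinarith [Real.exp_one_lt_d9, Real.exp_pos (1 / 2)]

theorem innerCutoff_of_notMem {s : ℝ} (hs : s ∉ Set.Icc (0 : ℝ) 1) : innerCutoff s = 0 :=
  Set.indicator_of_notMem hs _

theorem measurable_innerCutoff : Measurable innerCutoff :=
  Measurable.indicator (by fun_prop) measurableSet_Icc

theorem eq_zero_of_notMem_Icc {χ : ℝ → ℝ} (hχ : tsupport χ ⊆ Set.Icc (-1) 1) {t : ℝ}
    (ht : t ∉ Set.Icc (-1 : ℝ) 1) : χ t = 0 :=
  image_eq_zero_of_notMem_tsupport fun h => ht (hχ h)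

theorem dampedWaveKernel_eq {χ : ℝ → ℝ} (hχ : tsupport χ ⊆ Set.Icc (-1) 1) (t s : ℝ)
    (x : Torus2) : dampedWaveKernel χ t s x
      = innerCutoff s * (outerCutoff χ t * coneProfile (t - s) (torusAbs x)) := by
  unfold dampedWaveKernel innerCutoff outerCutoff
  by_cases ht : t ∈ Set.Icc (-1 : ℝ) 1
  swap
  · simp [eq_zero_of_notMem_Icc hχ ht]
  by_cases hs : 0 ≤ s
  swap
  · rw [Set.indicator_of_notMem (s := Set.Ici 0) (a := s) hs,
      Set.indicator_of_notMem (s := Set.Icc 0 1) (a := s) fun h => hs h.1]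
    simp
  by_cases hst : s ≤ t
  swap
  · rw [coneProfile_of_le (by linarith [torusAbs_nonneg x]),
      Set.indicator_of_notMem (s := Set.Ici s) (a := t) hst]
    simp
  rw [torusWaveKernel_eq_coneProfile (by linarith) (by linarith [ht.2]),
    Set.indicator_of_mem (s := Set.Ici s) (a := t) hst,
    Set.indicator_of_mem (s := Set.Ici 0) (a := s) hs,
    Set.indicator_of_mem (s := Set.Icc 0 1) (a := s) ⟨hs, hst.trans ht.2⟩]
  have : Real.exp (-(1 / 2) * (t - s)) = Real.exp (1 / 2 * s) * Real.exp (-(1 / 2) * t) := by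
    rw [← Real.exp_add]; congr 1; ring
  rw [this]; ring

theorem outerCutoff_of_notMem_Icc {χ : ℝ → ℝ} (hχ : tsupport χ ⊆ Set.Icc (-1) 1) {t : ℝ}
    (ht : t ∉ Set.Icc (-1 : ℝ) 1) : outerCutoff χ t = 0 := by
  rw [outerCutoff, eq_zero_of_notMem_Icc hχ ht, mul_zero]

theorem exists_outerCutoff_bound {χ : ℝ → ℝ} (hχ : ContDiff ℝ ∞ χ)
    (hsupp : tsupport χ ⊆ Set.Icc (-1) 1) :
    ∃ A : ℝ, 0 ≤ A ∧ (∀ t, |outerCutoff χ t| ≤ A) ∧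
      ∀ t t', |outerCutoff χ t - outerCutoff χ t'| ≤ A * |t - t'| := by
  have hb : ContDiff ℝ 1 (outerCutoff χ) := by
    unfold outerCutoff
    exact ContDiff.mul (by fun_prop) (hχ.of_le (by simp))
  have hc : HasCompactSupport (outerCutoff χ) :=
    HasCompactSupport.intro (isCompact_Icc (a := (-1 : ℝ)) (b := 1)) fun t ht =>
      outerCutoff_of_notMem_Icc hsupp ht
  obtain ⟨A₁, hA₁⟩ := hb.continuous.bounded_above_of_compact_support hc
  obtain ⟨A₂, hA₂⟩ := ContDiff.lipschitzWith_of_hasCompactSupport hc hb one_ne_zero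
  refine ⟨max A₁ A₂, le_max_of_le_right A₂.2, fun t => (hA₁ t).trans (le_max_left _ _),
    fun t t' => ?_⟩
  have := hA₂.dist_le_mul t t'
  rw [Real.dist_eq, Real.dist_eq] at this
  exact this.trans (by gcongr; exact le_max_right _ _)

/-! ### Pointwise bounds for the wave kernel -/

theorem coneProfile_eq_rpow {u r : ℝ} (hr : 0 ≤ r) (h : r < u) :
    coneProfile u r = (u + r) ^ (-(1 / 2) : ℝ) * (u - r) ^ (-(1 / 2) : ℝ) := by
  rw [coneProfile, if_pos h, ← Real.mul_rpow (by linarith) (by linarith), Real.rpow_neg (by nlinarith),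
    ← Real.sqrt_eq_rpow, one_div]
  congr 2; ring


theorem abs_coneProfile_sub_le {u r u' r' m : ℝ} (hr : 0 ≤ r) (hr' : 0 ≤ r')
    (hδ : 0 < |(|u| - r)|) (hu : |u - u'| ≤ m) (hrr : |r - r'| ≤ 2 * m)
    (hm : 12 * m ≤ |(|u| - r)|) :
    |coneProfile u r - coneProfile u' r'|
      ≤ 14 * m * ((|u| + r) ^ (-(1 / 2) : ℝ) * |(|u| - r)| ^ (-(3 / 2) : ℝ)) := by
  have hm0 : 0 ≤ m := (abs_nonneg _).trans hu
  obtain ⟨hu1, hu2⟩ := abs_le.1 hu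
  obtain ⟨hr1, hr2⟩ := abs_le.1 hrr
  rcases lt_or_ge r u with h | h
  · have hu0 : 0 < u := hr.trans_lt h
    rw [abs_of_pos hu0, abs_of_pos (sub_pos.2 h)] at *
    have hd' : 3 / 4 * (u - r) ≤ u' - r' := by linarith
    have he' : 3 / 4 * (u + r) ≤ u' + r' := by linarith
    have h' : r' < u' := by linarith
    have ha : 0 < u ^ 2 - r ^ 2 := by nlinarith
    have hb : (u ^ 2 - r ^ 2) / 4 ≤ u' ^ 2 - r' ^ 2 := by
      have := mul_le_mul hd' he' (by linarith) (by linarith)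
      nlinarith
    have hab : |(u ^ 2 - r ^ 2) - (u' ^ 2 - r' ^ 2)| ≤ 7 * m * (u + r) := by
      have e : (u ^ 2 - r ^ 2) - (u' ^ 2 - r' ^ 2)
          = ((u - r) - (u' - r')) * (u' + r') + (u - r) * ((u + r) - (u' + r')) := by ring
      rw [e]
      refine (abs_add_le _ _).trans ?_
      rw [abs_mul, abs_mul, abs_of_pos (by linarith : 0 < u' + r'),
        abs_of_pos (by linarith : 0 < u - r)]
      have h1 : |(u - r) - (u' - r')| ≤ 3 * m := abs_le.2 ⟨by linarith, by linarith⟩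
      have h2 : |(u + r) - (u' + r')| ≤ 3 * m := abs_le.2 ⟨by linarith, by linarith⟩
      have h3 : |(u - r) - (u' - r')| * (u' + r') ≤ 3 * m * (5 / 4 * (u + r)) :=
        mul_le_mul h1 (by linarith) (by linarith) (by linarith)
      have h4 : (u - r) * |(u + r) - (u' + r')| ≤ (u + r) * (3 * m) :=
        mul_le_mul (by linarith) h2 (abs_nonneg _) (by linarith)
      nlinarith [mul_nonneg hm0 (by linarith : 0 ≤ u + r)]
    rw [coneProfile, if_pos h, coneProfile, if_pos h']
    set a := u ^ 2 - r ^ 2 with had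
    set b := u' ^ 2 - r' ^ 2 with hbd
    have hsa : 0 < √a := Real.sqrt_pos.2 ha
    have hb0 : 0 < b := by linarith
    have hsb : √a / 2 ≤ √b := by
      refine Real.le_sqrt_of_sq_le ?_
      rw [div_pow, Real.sq_sqrt ha.le]; linarith
    have hsb0 : 0 < √b := by linarith
    have hdiff : |√b - √a| * √a ≤ |a - b| := by
      have : a - b = (√a - √b) * (√a + √b) := by
        nlinarith [Real.sq_sqrt ha.le, Real.sq_sqrt hb0.le]
      rw [this, abs_mul, abs_of_pos (by linarith : 0 < √a + √b), abs_sub_comm]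
      exact mul_le_mul_of_nonneg_left (by linarith) (abs_nonneg _)
    have hR : (u + r) ^ (-(1 / 2) : ℝ) * (u - r) ^ (-(3 / 2) : ℝ) = 1 / ((u - r) * √a) := by
      have e : (-(3 / 2) : ℝ) = -1 + -(1 / 2) := by norm_num
      rw [e, Real.rpow_add (by linarith), mul_left_comm,
        ← Real.mul_rpow (by linarith) (by linarith), Real.rpow_neg_one,
        Real.rpow_neg (by nlinarith), ← Real.sqrt_eq_rpow, one_div, mul_inv, had]
      congr 3; ring
    rw [hR]
    have e1 : 1 / √a - 1 / √b = (√b - √a) / (√a * √b) := by field_simp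
    rw [e1, abs_div, abs_of_pos (mul_pos hsa hsb0), mul_one_div]
    rw [div_le_div_iff₀ (mul_pos hsa hsb0) (mul_pos (by linarith) hsa)]
    have hae : a = (u - r) * (u + r) := by rw [had]; ring
    have h5 : |√b - √a| * √a ≤ 7 * m * (u + r) := hdiff.trans hab
    calc |√b - √a| * ((u - r) * √a) = (|√b - √a| * √a) * (u - r) := by ring
      _ ≤ (7 * m * (u + r)) * (u - r) := mul_le_mul_of_nonneg_right h5 (by linarith)
      _ = 7 * m * a := by rw [hae]; ring
      _ = 7 * m * (√a * √a) := by rw [Real.mul_self_sqrt ha.le]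
      _ = 14 * m * (√a * (√a / 2)) := by ring
      _ ≤ 14 * m * (√a * √b) := by gcongr
  · have hd : |(|u| - r)| ≤ r - u := by
      rw [abs_le]; constructor
      · linarith [le_abs_self u]
      · rcases le_total 0 u with h0 | h0
        · rw [abs_of_nonneg h0]; linarith
        · rw [abs_of_nonpos h0]; linarith
    rw [coneProfile_of_le h, coneProfile_of_le (by linarith), sub_zero, abs_zero]
    positivity

theorem ofReal_coneProfile_le (u : ℝ) {r : ℝ} (hr : 0 ≤ r) :
    ENNReal.ofReal (coneProfile u r)
      ≤ ‖u - r‖ₑ ^ (-(1 / 2) : ℝ) * ENNReal.ofReal r ^ (-(1 / 2) : ℝ) := by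
  rcases le_or_gt u r with h | h
  · simp [coneProfile_of_le h]
  rcases hr.eq_or_lt with rfl | hr
  · rw [ENNReal.ofReal_zero, ENNReal.zero_rpow_of_neg (by norm_num), ENNReal.mul_top]
    · exact le_top
    · simp [ENNReal.rpow_eq_zero_iff]
  · rw [coneProfile_eq_rpow hr.le h, ENNReal.ofReal_mul (Real.rpow_nonneg (by linarith) _), mul_comm,
      Real.enorm_eq_ofReal (by linarith), ENNReal.ofReal_rpow_of_pos (by linarith),
      ENNReal.ofReal_rpow_of_pos hr]
    gcongr 1
    exact ENNReal.ofReal_le_ofReal (Real.rpow_le_rpow_of_nonpos hr (by linarith) (by norm_num))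

theorem coneProfile_mul_rpow_le {u r σ : ℝ} (hr : 0 ≤ r) :
    coneProfile u r * |(|u| - r)| ^ (-σ)
      ≤ (|u| + r) ^ (-(1 / 2) : ℝ) * |(|u| - r)| ^ (-(1 / 2) - σ) := by
  rcases le_or_gt u r with h | h
  · rw [coneProfile_of_le h, zero_mul]; positivity
  rw [abs_of_pos (hr.trans_lt h), abs_of_pos (sub_pos.2 h), coneProfile_eq_rpow hr h, mul_assoc,
    ← Real.rpow_add (by linarith), ← sub_eq_add_neg (-(1 / 2))]

theorem coneProfile_le {u r σ : ℝ} (hr : 0 ≤ r) (hu : |u| ≤ 3) (hσ : 0 ≤ σ) (hσ' : σ < 1 / 2) :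
    coneProfile u r ≤ 2 * ((|u| + r) ^ (-(1 / 2) : ℝ) * |(|u| - r)| ^ (-(1 / 2) - σ)) := by
  refine le_trans ?_ (mul_le_mul_of_nonneg_left (coneProfile_mul_rpow_le hr) zero_le_two)
  rcases le_or_gt u r with h | h
  · rw [coneProfile_of_le h]; simp
  have hd : 0 < u - r := sub_pos.2 h
  rw [abs_of_pos (hr.trans_lt h)] at *
  rw [abs_of_pos hd]
  have h1 : (u - r) ^ σ ≤ 2 := by
    calc (u - r) ^ σ ≤ 3 ^ σ := Real.rpow_le_rpow hd.le (by linarith) hσ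
      _ ≤ 3 ^ (1 / 2 : ℝ) := Real.rpow_le_rpow_of_exponent_le (by norm_num) hσ'.le
      _ ≤ 2 := by
        rw [← Real.sqrt_eq_rpow, Real.sqrt_le_left (by norm_num)]; norm_num
  have h2 : 1 ≤ 2 * (u - r) ^ (-σ) := by
    rw [Real.rpow_neg hd.le, ← div_eq_mul_inv, one_le_div (by positivity)]; exact h1
  nlinarith [coneProfile_nonneg u r]

/-! ### One-dimensional integrals -/

theorem lintegral_comp_abs {h : ℝ → ℝ≥0∞} :
    ∫⁻ v : ℝ, h |v| = 2 * ∫⁻ v in Set.Ioi (0 : ℝ), h v := by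
  have h1 : ∫⁻ v in Set.Ioi (0 : ℝ), h |v| = ∫⁻ v in Set.Ioi (0 : ℝ), h v :=
    setLIntegral_congr_fun measurableSet_Ioi fun v hv => by rw [abs_of_pos hv]
  have h2 : ∫⁻ v in Set.Iio (0 : ℝ), h |v| = ∫⁻ v in Set.Ioi (0 : ℝ), h v := by
    have := (Measure.measurePreserving_neg (volume : Measure ℝ)).setLIntegral_comp_preimage_emb
      (MeasurableEquiv.neg ℝ).measurableEmbedding (fun v => h |v|) (Set.Iio 0)
    rw [← this, ← h1]
    simp
  rw [← lintegral_add_compl _ (measurableSet_Ioi (a := (0 : ℝ))), h1, Set.compl_Ioi,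
    setLIntegral_congr Iio_ae_eq_Iic.symm, h2, two_mul]

theorem lintegral_enorm_rpow_lt {a r : ℝ} (ha : a < 1) (hr : 0 ≤ r) :
    ∫⁻ v : ℝ, (if |v| < r then ‖v‖ₑ ^ (-a) else 0)
      = ENNReal.ofReal (2 / (1 - a) * r ^ (1 - a)) := by
  have h0 : ∀ v : ℝ, (if |v| < r then ‖v‖ₑ ^ (-a) else 0)
      = (fun x : ℝ => if x < r then (ENNReal.ofReal x) ^ (-a) else 0) |v| := fun v => by
    simp only [Real.enorm_eq_ofReal_abs]
  rw [lintegral_congr h0,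
    lintegral_comp_abs (h := fun x : ℝ => if x < r then (ENNReal.ofReal x) ^ (-a) else 0)]
  have h1 : ∫⁻ v in Set.Ioi (0 : ℝ), (if v < r then (ENNReal.ofReal v) ^ (-a) else 0)
      = ∫⁻ v in Set.Ioo 0 r, ENNReal.ofReal (v ^ (-a)) := by
    rw [← lintegral_indicator measurableSet_Ioi, ← lintegral_indicator measurableSet_Ioo]
    congr 1 with v
    simp only [Set.indicator, Set.mem_Ioi, Set.mem_Ioo]
    split_ifs with h1 h2 h3 h3 <;> first | rfl | (exfalso; tauto) | skip
    rw [ENNReal.ofReal_rpow_of_pos h1]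
  have hint : IntegrableOn (fun v : ℝ => v ^ (-a)) (Set.Ioc 0 r) := by
    rw [← intervalIntegrable_iff_integrableOn_Ioc_of_le hr]
    exact intervalIntegral.intervalIntegrable_rpow' (by linarith)
  rw [h1, setLIntegral_congr Ioo_ae_eq_Ioc, ← ofReal_integral_eq_lintegral_ofReal hint, ← intervalIntegral.integral_of_le hr,
    integral_rpow (Or.inl (by linarith)), Real.zero_rpow (by linarith), ← ENNReal.ofReal_ofNat,
    ← ENNReal.ofReal_mul (by norm_num)]
  · congr 1
    rw [show -a + 1 = 1 - a by ring]; ring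
  · exact (ae_restrict_mem measurableSet_Ioc).mono fun v hv => Real.rpow_nonneg hv.1.le _

theorem lintegral_add_abs_rpow {k δ : ℝ} (hk : 1 < k) (hδ : 0 < δ) :
    ∫⁻ v : ℝ, ENNReal.ofReal ((δ + |v|) ^ (-k)) = ENNReal.ofReal (2 / (k - 1) * δ ^ (1 - k)) := by
  rw [lintegral_comp_abs (h := fun v => ENNReal.ofReal ((δ + v) ^ (-k)))]
  have h1 : ∫⁻ v in Set.Ioi (0 : ℝ), ENNReal.ofReal ((δ + v) ^ (-k))
      = ∫⁻ v in Set.Ioi δ, ENNReal.ofReal (v ^ (-k)) := by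
    have := (measurePreserving_add_left (volume : Measure ℝ) δ).setLIntegral_comp_preimage_emb
      (MeasurableEquiv.addLeft δ).measurableEmbedding (fun v => ENNReal.ofReal (v ^ (-k)))
      (Set.Ioi δ)
    rw [← this]
    simp
  rw [h1, ← ofReal_integral_eq_lintegral_ofReal (integrableOn_Ioi_rpow_of_lt (by linarith) hδ),
    integral_Ioi_rpow_of_lt (by linarith) hδ, ← ENNReal.ofReal_ofNat,
    ← ENNReal.ofReal_mul (by norm_num)]
  · congr 1
    rw [show -k + 1 = -(k - 1) by ring, show 1 - k = -(k - 1) by ring]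
    rw [neg_div_neg_eq]; ring
  · exact (ae_restrict_mem measurableSet_Ioi).mono fun v hv =>
      Real.rpow_nonneg (hδ.trans hv).le _

theorem lintegral_enorm_sub_rpow_mul_le {k A : ℝ} (hk : 1 < k) (hA : 0 < A) (a : ℝ) :
    ∫⁻ v : ℝ, ‖a - v‖ₑ ^ (-(1 / 2) : ℝ) * ENNReal.ofReal ((A + |v|) ^ (-k))
      ≤ ENNReal.ofReal ((4 + 2 / (k - 1)) * A ^ (1 / 2 - k)) := by
  have hpt : ∀ v : ℝ, ‖a - v‖ₑ ^ (-(1 / 2) : ℝ) * ENNReal.ofReal ((A + |v|) ^ (-k))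
      ≤ (if |a - v| < A then ‖a - v‖ₑ ^ (-(1 / 2) : ℝ) else 0) * ENNReal.ofReal (A ^ (-k))
        + ENNReal.ofReal (A ^ (-(1 / 2) : ℝ)) * ENNReal.ofReal ((A + |v|) ^ (-k)) := by
    intro v
    split_ifs with h
    · refine le_add_right ?_
      refine mul_le_mul_right (ENNReal.ofReal_le_ofReal ?_) _
      exact Real.rpow_le_rpow_of_nonpos hA (by linarith [abs_nonneg v]) (by linarith)
    · refine le_add_left ?_
      gcongr
      rw [not_lt] at h
      rw [Real.enorm_eq_ofReal_abs, ENNReal.ofReal_rpow_of_pos (hA.trans_le h)]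
      exact ENNReal.ofReal_le_ofReal (Real.rpow_le_rpow_of_nonpos hA h (by norm_num))
  refine (lintegral_mono hpt).trans ?_
  rw [lintegral_add_right _ (by fun_prop), lintegral_const_mul _ (by fun_prop),
    lintegral_mul_const', lintegral_add_abs_rpow hk hA]
  · have := lintegral_sub_left_eq_self
      (fun v : ℝ => if |v| < A then ‖v‖ₑ ^ (-(1 / 2) : ℝ) else 0) a (μ := volume)
    rw [this, lintegral_enorm_rpow_lt (by norm_num) hA.le, ← ENNReal.ofReal_mul (by positivity),
      ← ENNReal.ofReal_mul (by positivity), ← ENNReal.ofReal_add]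
    · refine ENNReal.ofReal_le_ofReal (le_of_eq ?_)
      have e1 : A ^ (1 - 1 / 2 : ℝ) * A ^ (-k) = A ^ (1 / 2 - k) := by
        rw [← Real.rpow_add hA]; congr 1; ring
      have e2 : A ^ (-(1 / 2) : ℝ) * A ^ (1 - k) = A ^ (1 / 2 - k) := by
        rw [← Real.rpow_add hA]; congr 1; ring
      rw [mul_assoc, e1, mul_left_comm, e2]; ring
    · positivity
    · have : 0 < k - 1 := by linarith
      positivity
  · exact ENNReal.ofReal_ne_top

/-! ### Integrals over the translation group `ℝ × ℝ²` -/

/-- The projection of `ℝ²` onto the torus. -/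
noncomputable def torusMk (v : ℝ × ℝ) : Torus2 := ((v.1 : AddCircle (2 * π)), (v.2 : AddCircle (2 * π)))

theorem continuous_torusMk : Continuous torusMk :=
  ((AddCircle.continuous_mk' _).comp continuous_fst).prodMk
    ((AddCircle.continuous_mk' _).comp continuous_snd)

/-- The Euclidean norm on `ℝ × ℝ²`. -/
noncomputable def spaceTimeNorm (w : ℝ × ℝ × ℝ) : ℝ := √(w.1 ^ 2 + (w.2.1 ^ 2 + w.2.2 ^ 2))

theorem norm_le_spaceTimeNorm (w : ℝ × ℝ × ℝ) : ‖w‖ ≤ spaceTimeNorm w := by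
  simp only [Prod.norm_def, Real.norm_eq_abs, sup_le_iff]
  refine ⟨?_, ?_, ?_⟩ <;> refine Real.abs_le_sqrt ?_ <;> nlinarith [sq_nonneg w.1, sq_nonneg w.2.1, sq_nonneg w.2.2]

theorem continuous_spaceTimeNorm : Continuous spaceTimeNorm := by
  unfold spaceTimeNorm; fun_prop

theorem abs_fst_le_norm (w : ℝ × ℝ × ℝ) : |w.1| ≤ ‖w‖ := norm_fst_le w

theorem abs_snd_fst_le_norm (w : ℝ × ℝ × ℝ) : |w.2.1| ≤ ‖w‖ :=
  (norm_fst_le w.2).trans (norm_snd_le w)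

theorem abs_snd_snd_le_norm (w : ℝ × ℝ × ℝ) : |w.2.2| ≤ ‖w‖ :=
  (norm_snd_le w.2).trans (norm_snd_le w)

theorem lintegral_prod_mul_mul {f g h : ℝ → ℝ≥0∞} (hf : Measurable f) (hg : Measurable g)
    (hh : Measurable h) : ∫⁻ w : ℝ × ℝ × ℝ, f w.1 * (g w.2.1 * h w.2.2)
      = (∫⁻ v, f v) * ((∫⁻ v, g v) * ∫⁻ v, h v) := by
  rw [← lintegral_prod_mul hg.aemeasurable hh.aemeasurable,
    ← lintegral_prod_mul hf.aemeasurable (by fun_prop)]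
  rfl

theorem ENNReal.rpow_neg_le_rpow_neg {x y : ℝ≥0∞} {a : ℝ} (ha : 0 ≤ a) (h : x ≤ y) :
    y ^ (-a) ≤ x ^ (-a) := by
  rw [ENNReal.rpow_neg, ENNReal.rpow_neg]
  exact ENNReal.inv_le_inv.2 (ENNReal.rpow_le_rpow h ha)

theorem ENNReal.rpow_neg_add {x : ℝ≥0∞} {a b : ℝ} (ha : 0 ≤ a) (hb : 0 ≤ b) (hx : x ≠ ⊤) :
    x ^ (-(a + b)) = x ^ (-a) * x ^ (-b) := by
  rw [ENNReal.rpow_neg, ENNReal.rpow_neg, ENNReal.rpow_neg, ENNReal.rpow_add_of_nonneg _ _ ha hb,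
    ENNReal.mul_inv (Or.inr (ENNReal.rpow_ne_top_of_nonneg hb hx))
      (Or.inl (ENNReal.rpow_ne_top_of_nonneg ha hx))]

theorem exists_lintegral_enorm_rpow_le {σ : ℝ} (hσ0 : 0 ≤ σ) (hσ : σ < 1) :
    ∃ C : ℝ, 0 ≤ C ∧ ∀ δ : ℝ, 0 < δ →
      ∫⁻ w : ℝ × ℝ × ℝ, (if ‖w‖ < δ then ‖w‖ₑ ^ (-2 - σ) else 0)
        ≤ ENNReal.ofReal (C * δ ^ (1 - σ)) := by
  set a : ℝ := (2 + σ) / 3 with ha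
  have ha1 : a < 1 := by rw [ha]; linarith
  have h1a : 0 < 1 - a := by linarith
  refine ⟨(2 / (1 - a)) ^ 3, by positivity, fun δ hδ => ?_⟩
  have hm : Measurable fun v : ℝ => if |v| < δ then ‖v‖ₑ ^ (-a) else 0 :=
    Measurable.ite (measurableSet_lt (by fun_prop) measurable_const) (by fun_prop)
      measurable_const
  refine (lintegral_mono (g := fun w : ℝ × ℝ × ℝ => (if |w.1| < δ then ‖w.1‖ₑ ^ (-a) else 0)
    * ((if |w.2.1| < δ then ‖w.2.1‖ₑ ^ (-a) else 0)
      * (if |w.2.2| < δ then ‖w.2.2‖ₑ ^ (-a) else 0))) fun w => ?_).trans ?_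
  · by_cases h0 : ‖w‖ < δ
    swap
    · rw [if_neg h0]; exact zero_le
    rw [if_pos h0]
    dsimp only
    rw [if_pos ((abs_fst_le_norm w).trans_lt h0), if_pos ((abs_snd_fst_le_norm w).trans_lt h0),
      if_pos ((abs_snd_snd_le_norm w).trans_lt h0)]
    have ha0 : 0 ≤ a := by rw [ha]; linarith
    have he : ∀ y : ℝ, |y| ≤ ‖w‖ → ‖w‖ₑ ^ (-a) ≤ ‖y‖ₑ ^ (-a) := fun y hy =>
      ENNReal.rpow_neg_le_rpow_neg ha0 (enorm_le_iff_norm_le.2 hy)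
    rw [show -2 - σ = -(a + (a + a)) by rw [ha]; ring, ENNReal.rpow_neg_add ha0 (by linarith) (by simp),
      ENNReal.rpow_neg_add ha0 ha0 (by simp)]
    exact mul_le_mul' (he _ (abs_fst_le_norm w))
      (mul_le_mul' (he _ (abs_snd_fst_le_norm w)) (he _ (abs_snd_snd_le_norm w)))
  · rw [lintegral_prod_mul_mul hm hm hm, lintegral_enorm_rpow_lt ha1 hδ.le,
      ← ENNReal.ofReal_mul (by positivity), ← ENNReal.ofReal_mul (by positivity)]
    refine ENNReal.ofReal_le_ofReal (le_of_eq ?_)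
    have : δ ^ (1 - σ) = δ ^ (1 - a) * (δ ^ (1 - a) * δ ^ (1 - a)) := by
      rw [← Real.rpow_add hδ, ← Real.rpow_add hδ]; congr 1; rw [ha]; ring
    rw [this]; ring

theorem lintegral_far_le {σ δ : ℝ} (hσ : 0 < σ) (hδ : 0 < δ) :
    ∫⁻ w : ℝ × ℝ × ℝ, ENNReal.ofReal ((δ + |w.1| + (|w.2.1| + |w.2.2|)) ^ (-3 - σ))
      ≤ ENNReal.ofReal ((6 / σ) ^ 3 * δ ^ (-σ)) := by
  set k : ℝ := 1 + σ / 3 with hk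
  have hk1 : 1 < k := by rw [hk]; linarith
  have hm : Measurable fun v : ℝ => ENNReal.ofReal ((δ + |v|) ^ (-k)) := by fun_prop
  refine (lintegral_mono (g := fun w : ℝ × ℝ × ℝ => ENNReal.ofReal ((δ + |w.1|) ^ (-k))
    * (ENNReal.ofReal ((δ + |w.2.1|) ^ (-k))
      * ENNReal.ofReal ((δ + |w.2.2|) ^ (-k)))) fun w => ?_).trans ?_
  · dsimp only
    rw [← ENNReal.ofReal_mul (by positivity), ← ENNReal.ofReal_mul (by positivity)]
    refine ENNReal.ofReal_le_ofReal ?_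
    have hb : ∀ v ≤ |w.1| + (|w.2.1| + |w.2.2|), 0 ≤ v →
        (δ + |w.1| + (|w.2.1| + |w.2.2|)) ^ (-k) ≤ (δ + v) ^ (-k) := fun v hv hv0 =>
      Real.rpow_le_rpow_of_nonpos (by linarith) (by linarith) (by linarith)
    have h1 := abs_nonneg w.1
    have h2 := abs_nonneg w.2.1
    have h3 := abs_nonneg w.2.2
    calc _ = (δ + |w.1| + (|w.2.1| + |w.2.2|)) ^ (-k) * ((δ + |w.1| + (|w.2.1| + |w.2.2|)) ^ (-k)
          * (δ + |w.1| + (|w.2.1| + |w.2.2|)) ^ (-k)) := by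
          rw [← Real.rpow_add (by positivity), ← Real.rpow_add (by positivity)]
          congr 1; rw [hk]; ring
      _ ≤ _ := by
        refine mul_le_mul (hb _ (by linarith) h1) ?_ (by positivity) (by positivity)
        exact mul_le_mul (hb _ (by linarith) h2) (hb _ (by linarith) h3) (by positivity)
          (by positivity)
  · rw [lintegral_prod_mul_mul hm hm hm, lintegral_add_abs_rpow hk1 hδ]
    have hk1' : 0 < k - 1 := by linarith
    rw [← ENNReal.ofReal_mul (by positivity), ← ENNReal.ofReal_mul (by positivity)]
    refine ENNReal.ofReal_le_ofReal (le_of_eq ?_)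
    have e1 : δ ^ (-σ) = δ ^ (1 - k) * (δ ^ (1 - k) * δ ^ (1 - k)) := by
      rw [← Real.rpow_add hδ, ← Real.rpow_add hδ]; congr 1; rw [hk]; ring
    have e2 : 2 / (k - 1) = 6 / σ := by rw [hk, add_sub_cancel_left, div_div_eq_mul_div]; norm_num
    rw [e1, e2]; ring

theorem setLIntegral_norm_sub_coe_le (h : ℝ → ℝ≥0∞) (x : AddCircle (2 * π)) :
    ∫⁻ v in Set.Ioo (-1 : ℝ) 1, h ‖x - (v : AddCircle (2 * π))‖ ≤ ∫⁻ v : ℝ, h |v| := by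
  have hpi := Real.pi_gt_three
  calc ∫⁻ v in Set.Ioo (-1 : ℝ) 1, h ‖x - (v : AddCircle (2 * π))‖
      ≤ ∫⁻ v in Set.Ioc (-π) (-π + 2 * π), h ‖x - (v : AddCircle (2 * π))‖ :=
        lintegral_mono_set fun v hv => ⟨by linarith [hv.1], by linarith [hv.2]⟩
    _ = ∫⁻ b : AddCircle (2 * π), h ‖x - b‖ :=
        AddCircle.lintegral_preimage (2 * π) (-π) (fun b => h ‖x - b‖)
    _ = ∫⁻ b : AddCircle (2 * π), h ‖b‖ :=
        lintegral_sub_left_eq_self (fun b : AddCircle (2 * π) => h ‖b‖) x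
    _ = ∫⁻ v in Set.Ioc (-π) (-π + 2 * π), h ‖(v : AddCircle (2 * π))‖ :=
        (AddCircle.lintegral_preimage (2 * π) (-π) (fun b => h ‖b‖)).symm
    _ = ∫⁻ v in Set.Ioc (-π) (-π + 2 * π), h |v| := by
        refine setLIntegral_congr_fun measurableSet_Ioc fun v hv => ?_
        rw [(AddCircle.norm_coe_eq_abs_iff (2 * π) (by positivity)).2]
        rw [abs_of_pos Real.two_pi_pos, abs_le]
        constructor <;> linarith [hv.1, hv.2]
    _ ≤ ∫⁻ v : ℝ, h |v| := setLIntegral_le_lintegral _ _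

theorem setLIntegral_torusAbs_rpow_le {r : ℝ} (hr : 0 ≤ r) (x : Torus2) :
    ∫⁻ v in Set.Ioo (-1 : ℝ) 1 ×ˢ Set.Ioo (-1 : ℝ) 1,
        (if torusAbs (x - torusMk v) < r
          then ENNReal.ofReal (torusAbs (x - torusMk v)) ^ (-(1 / 2) : ℝ) else 0)
      ≤ ENNReal.ofReal (8 * r ^ (3 / 2 : ℝ)) := by
  let h : ℝ → ℝ≥0∞ := fun y => if y < r then ENNReal.ofReal y ^ (-(1 / 4) : ℝ) else 0
  have hh : Measurable h :=
    Measurable.ite measurableSet_Iio (by fun_prop) measurable_const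
  have hint : ∫⁻ v : ℝ, h |v| = ENNReal.ofReal (8 / 3 * r ^ (3 / 4 : ℝ)) := by
    have := lintegral_enorm_rpow_lt (a := 1 / 4) (by norm_num) hr
    simp only [Real.enorm_eq_ofReal_abs] at this
    rw [this]; norm_num
  have hcont : ∀ a : AddCircle (2 * π), Measurable fun v : ℝ => h ‖a - (v : AddCircle (2 * π))‖ :=
    fun a => hh.comp (Continuous.measurable
      ((continuous_const.sub (AddCircle.continuous_mk' _)).norm))
  refine (lintegral_mono (g := fun v : ℝ × ℝ => h ‖x.1 - (v.1 : AddCircle (2 * π))‖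
    * h ‖x.2 - (v.2 : AddCircle (2 * π))‖) fun v => ?_).trans ?_
  · by_cases h0 : torusAbs (x - torusMk v) < r
    swap
    · rw [if_neg h0]; exact zero_le
    rw [if_pos h0]
    have h1 := norm_fst_le_torusAbs (x - torusMk v)
    have h2 := norm_snd_le_torusAbs (x - torusMk v)
    have e1 : ‖x.1 - (v.1 : AddCircle (2 * π))‖ < r := h1.trans_lt h0
    have e2 : ‖x.2 - (v.2 : AddCircle (2 * π))‖ < r := h2.trans_lt h0
    simp only [h, if_pos e1, if_pos e2]
    rw [show (-(1 / 2) : ℝ) = -(1 / 4 + 1 / 4) by norm_num,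
      ENNReal.rpow_neg_add (by norm_num) (by norm_num) ENNReal.ofReal_ne_top]
    exact mul_le_mul'
      (ENNReal.rpow_neg_le_rpow_neg (by norm_num) (ENNReal.ofReal_le_ofReal h1))
      (ENNReal.rpow_neg_le_rpow_neg (by norm_num) (ENNReal.ofReal_le_ofReal h2))
  · rw [Measure.volume_eq_prod, ← Measure.prod_restrict,
      lintegral_prod_mul (hcont _).aemeasurable (hcont _).aemeasurable]
    refine (mul_le_mul' (setLIntegral_norm_sub_coe_le h _)
      (setLIntegral_norm_sub_coe_le h _)).trans ?_
    rw [hint, ← ENNReal.ofReal_mul (by positivity)]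
    refine ENNReal.ofReal_le_ofReal ?_
    have : r ^ (3 / 2 : ℝ) = r ^ (3 / 4 : ℝ) * r ^ (3 / 4 : ℝ) := by
      rw [← Real.rpow_add_of_nonneg hr (by norm_num) (by norm_num)]; norm_num
    rw [this]
    have := Real.rpow_nonneg hr (3 / 4)
    nlinarith [mul_nonneg this this]

theorem lintegral_add_abs_add_abs_rpow {k δ : ℝ} (hk : 2 < k) (hδ : 0 < δ) :
    ∫⁻ v : ℝ × ℝ, ENNReal.ofReal ((δ + (|v.1| + |v.2|)) ^ (-k))
      ≤ ENNReal.ofReal ((4 / (k - 2)) ^ 2 * δ ^ (2 - k)) := by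
  have hk1 : 1 < k / 2 := by linarith
  have hm : Measurable fun v : ℝ => ENNReal.ofReal ((δ + |v|) ^ (-(k / 2))) := by fun_prop
  refine (lintegral_mono (g := fun v : ℝ × ℝ => ENNReal.ofReal ((δ + |v.1|) ^ (-(k / 2)))
    * ENNReal.ofReal ((δ + |v.2|) ^ (-(k / 2)))) fun v => ?_).trans ?_
  · dsimp only
    rw [← ENNReal.ofReal_mul (by positivity)]
    refine ENNReal.ofReal_le_ofReal ?_
    have h1 := abs_nonneg v.1
    have h2 := abs_nonneg v.2
    rw [show -k = -(k / 2) + -(k / 2) by ring, Real.rpow_add (by positivity)]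
    refine mul_le_mul ?_ ?_ (by positivity) (by positivity) <;>
    exact Real.rpow_le_rpow_of_nonpos (by linarith) (by linarith) (by linarith)
  · rw [Measure.volume_eq_prod, lintegral_prod_mul hm.aemeasurable hm.aemeasurable,
      lintegral_add_abs_rpow hk1 hδ]
    have hk2 : 0 < k / 2 - 1 := by linarith
    rw [← ENNReal.ofReal_mul (by positivity)]
    refine ENNReal.ofReal_le_ofReal (le_of_eq ?_)
    have e1 : δ ^ (2 - k) = δ ^ (1 - k / 2) * δ ^ (1 - k / 2) := by
      rw [← Real.rpow_add hδ]; congr 1; ring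
    have e2 : 4 / (k - 2) = 2 / (k / 2 - 1) := by
      have : k - 2 ≠ 0 := by linarith
      rw [div_eq_div_iff this hk2.ne']; ring
    rw [e1, e2]; ring

theorem torusAbs_sub_torusMk_le (x : Torus2) (v : ℝ × ℝ) :
    |torusAbs x - torusAbs (x - torusMk v)| ≤ |v.1| + |v.2| := by
  refine (abs_torusAbs_sub_le _ _).trans ?_
  simp only [torusMk, Prod.fst_sub, Prod.snd_sub, sub_sub_cancel]
  exact add_le_add (norm_coe_addCircle_le _) (norm_coe_addCircle_le _)

theorem exists_lintegral_spatial_le {k : ℝ} (hk : 2 < k) :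
    ∃ C : ℝ, 0 ≤ C ∧ ∀ (δ : ℝ) (x : Torus2), 0 < δ → 0 < torusAbs x →
      ∫⁻ v in Set.Ioo (-1 : ℝ) 1 ×ˢ Set.Ioo (-1 : ℝ) 1,
          ENNReal.ofReal (torusAbs (x - torusMk v)) ^ (-(1 / 2) : ℝ)
            * ENNReal.ofReal ((δ + (|v.1| + |v.2|)) ^ (-k))
        ≤ ENNReal.ofReal (C * (torusAbs x ^ (-(1 / 2) : ℝ) * δ ^ (2 - k))) := by
  have hk2 : 0 < k - 2 := by linarith
  refine ⟨2 * (4 / (k - 2)) ^ 2 + 32, by positivity, fun δ x hδ hx => ?_⟩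
  set r := torusAbs x with hr
  have hmρ : Measurable fun v : ℝ × ℝ => torusAbs (x - torusMk v) :=
    (continuous_torusAbs.comp (continuous_const.sub continuous_torusMk)).measurable
  have hpt : ∀ v : ℝ × ℝ, ENNReal.ofReal (torusAbs (x - torusMk v)) ^ (-(1 / 2) : ℝ)
        * ENNReal.ofReal ((δ + (|v.1| + |v.2|)) ^ (-k))
      ≤ ENNReal.ofReal (2 * r ^ (-(1 / 2) : ℝ)) * ENNReal.ofReal ((δ + (|v.1| + |v.2|)) ^ (-k))
        + (if torusAbs (x - torusMk v) < r then
            ENNReal.ofReal (torusAbs (x - torusMk v)) ^ (-(1 / 2) : ℝ) else 0)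
          * ENNReal.ofReal (4 * (r ^ (-2 : ℝ) * δ ^ (2 - k))) := by
    intro v
    set ρ := torusAbs (x - torusMk v) with hρ
    have h1 := abs_nonneg v.1
    have h2 := abs_nonneg v.2
    rcases le_or_gt (r / 2) ρ with h | h
    · refine le_add_right ?_
      gcongr
      rw [ENNReal.ofReal_rpow_of_pos (by linarith)]
      refine ENNReal.ofReal_le_ofReal ?_
      calc ρ ^ (-(1 / 2) : ℝ) ≤ (r / 2) ^ (-(1 / 2) : ℝ) :=
            Real.rpow_le_rpow_of_nonpos (by linarith) h (by norm_num)
        _ = 2 ^ (1 / 2 : ℝ) * r ^ (-(1 / 2) : ℝ) := by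
            rw [Real.div_rpow hx.le zero_le_two, Real.rpow_neg zero_le_two, div_inv_eq_mul,
              mul_comm]
        _ ≤ 2 * r ^ (-(1 / 2) : ℝ) := by
            gcongr
            calc (2 : ℝ) ^ (1 / 2 : ℝ) ≤ 2 ^ (1 : ℝ) :=
                  Real.rpow_le_rpow_of_exponent_le one_le_two (by norm_num)
              _ = 2 := Real.rpow_one 2
    · refine le_add_left ?_
      rw [if_pos (by linarith)]
      refine mul_le_mul_right (ENNReal.ofReal_le_ofReal ?_) _
      have h3 := (abs_le.1 (torusAbs_sub_torusMk_le x v)).2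
      rw [← hr, ← hρ] at h3
      rw [show -k = -2 + (2 - k) by ring, Real.rpow_add (by linarith), ← mul_assoc]
      refine mul_le_mul ?_ ?_ (by positivity) (by positivity)
      · calc (δ + (|v.1| + |v.2|)) ^ (-2 : ℝ) ≤ (r / 2) ^ (-2 : ℝ) :=
            Real.rpow_le_rpow_of_nonpos (by linarith) (by linarith) (by norm_num)
          _ = 4 * r ^ (-2 : ℝ) := by
            rw [Real.div_rpow hx.le zero_le_two, Real.rpow_neg zero_le_two, div_inv_eq_mul,
              mul_comm]
            norm_num
      · exact Real.rpow_le_rpow_of_nonpos (by linarith) (by linarith) (by linarith)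
  refine (lintegral_mono hpt).trans ?_
  rw [lintegral_add_left (by fun_prop), lintegral_const_mul _ (by fun_prop),
    lintegral_mul_const' _ _ ENNReal.ofReal_ne_top]
  refine (add_le_add (mul_le_mul_right ((setLIntegral_le_lintegral _ _).trans
    (lintegral_add_abs_add_abs_rpow hk hδ)) _) (mul_le_mul_left
      (setLIntegral_torusAbs_rpow_le hx.le x) _)).trans ?_
  rw [← ENNReal.ofReal_mul (by positivity), ← ENNReal.ofReal_mul (by positivity),
    ← ENNReal.ofReal_add (by positivity) (by positivity)]
  refine ENNReal.ofReal_le_ofReal (le_of_eq ?_)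
  have e1 : r ^ (3 / 2 : ℝ) * r ^ (-2 : ℝ) = r ^ (-(1 / 2) : ℝ) := by
    rw [← Real.rpow_add hx]; norm_num
  linear_combination (32 * δ ^ (2 - k)) * e1

theorem exists_lintegral_coneProfile_le {σ : ℝ} (hσ : 0 ≤ σ) :
    ∃ C : ℝ, 0 ≤ C ∧ ∀ (δ u : ℝ) (x : Torus2), 0 < δ → 0 < torusAbs x →
      ∫⁻ w in {w : ℝ × ℝ × ℝ | ‖w‖ < 1},
          ENNReal.ofReal (coneProfile (u - w.1) (torusAbs (x - torusMk w.2)))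
            * ENNReal.ofReal ((δ + |w.1| + (|w.2.1| + |w.2.2|)) ^ (-3 - σ))
        ≤ ENNReal.ofReal (C * (torusAbs x ^ (-(1 / 2) : ℝ) * δ ^ (-(1 / 2) - σ))) := by
  obtain ⟨C, hC, h⟩ := exists_lintegral_spatial_le (k := 5 / 2 + σ) (by linarith)
  refine ⟨(4 + 2 / (2 + σ)) * C, by positivity, fun δ u x hδ hx => ?_⟩
  set S : Set (ℝ × ℝ) := Set.Ioo (-1 : ℝ) 1 ×ˢ Set.Ioo (-1 : ℝ) 1 with hS
  have hsub : {w : ℝ × ℝ × ℝ | ‖w‖ < 1} ⊆ Set.univ ×ˢ S := by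
    intro w hw
    rw [Set.mem_ofPred_eq] at hw
    have h1 := abs_lt.1 ((abs_snd_fst_le_norm w).trans_lt hw)
    have h2 := abs_lt.1 ((abs_snd_snd_le_norm w).trans_lt hw)
    exact ⟨trivial, ⟨h1.1, h1.2⟩, ⟨h2.1, h2.2⟩⟩
  have hmρ : Measurable fun v : ℝ × ℝ => torusAbs (x - torusMk v) :=
    (continuous_torusAbs.comp (continuous_const.sub continuous_torusMk)).measurable
  let f : ℝ × ℝ × ℝ → ℝ≥0∞ := fun w =>
    ENNReal.ofReal (torusAbs (x - torusMk w.2)) ^ (-(1 / 2) : ℝ)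
      * (‖u - torusAbs (x - torusMk w.2) - w.1‖ₑ ^ (-(1 / 2) : ℝ)
        * ENNReal.ofReal ((δ + (|w.2.1| + |w.2.2|) + |w.1|) ^ (-(3 + σ))))
  have hmρ' : Measurable fun w : ℝ × ℝ × ℝ => torusAbs (x - torusMk w.2) :=
    hmρ.comp measurable_snd
  have hf : Measurable f := by fun_prop
  calc _ ≤ ∫⁻ w in {w : ℝ × ℝ × ℝ | ‖w‖ < 1}, f w := by
        refine lintegral_mono fun w => ?_
        simp only [f]
        rw [← mul_assoc, mul_comm (ENNReal.ofReal (torusAbs _) ^ (-(1 / 2) : ℝ)),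
          sub_right_comm u, add_right_comm, ← neg_add' 3 σ]
        exact mul_le_mul_left (ofReal_coneProfile_le _ (torusAbs_nonneg _)) _
    _ ≤ ∫⁻ w in Set.univ ×ˢ S, f w := lintegral_mono_set hsub
    _ = ∫⁻ v in S, ∫⁻ y, f (y, v) := by
        rw [Measure.volume_eq_prod, ← Measure.prod_restrict, Measure.restrict_univ,
          lintegral_prod_symm' _ hf]
    _ ≤ ∫⁻ v in S, ENNReal.ofReal (4 + 2 / (2 + σ))
          * (ENNReal.ofReal (torusAbs (x - torusMk v)) ^ (-(1 / 2) : ℝ)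
            * ENNReal.ofReal ((δ + (|v.1| + |v.2|)) ^ (-(5 / 2 + σ)))) := by
        refine lintegral_mono fun v => ?_
        simp only [f]
        rw [lintegral_const_mul _ (by fun_prop), mul_left_comm]
        refine mul_le_mul_right ((lintegral_enorm_sub_rpow_mul_le (by linarith)
          (by positivity) _).trans (le_of_eq ?_)) _
        rw [← ENNReal.ofReal_mul (by positivity)]
        congr 3
        · ring
        · ring
    _ ≤ _ := by
        rw [lintegral_const_mul _ (by fun_prop)]
        refine (mul_le_mul_right (h δ x hδ hx) _).trans (le_of_eq ?_)
        rw [← ENNReal.ofReal_mul (by positivity)]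
        congr 1
        rw [show 2 - (5 / 2 + σ) = -(1 / 2) - σ by ring]
        ring

/-! ### The fractional difference of the wave kernel -/

/-- The density of the Lévy measure of `(-Δ)^{σ/2}` on `ℝ × ℝ²`, up to a constant. -/
noncomputable def levyKernel (σ : ℝ) (w : ℝ × ℝ × ℝ) : ℝ := spaceTimeNorm w ^ (-3 - σ)

theorem levyKernel_nonneg (σ : ℝ) (w : ℝ × ℝ × ℝ) : 0 ≤ levyKernel σ w :=
  Real.rpow_nonneg (Real.sqrt_nonneg _) _

theorem measurable_levyKernel (σ : ℝ) : Measurable (levyKernel σ) :=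
  continuous_spaceTimeNorm.measurable.pow_const _

theorem levyKernel_le {σ : ℝ} (hσ : 0 ≤ σ) {w : ℝ × ℝ × ℝ} (hw : w ≠ 0) :
    levyKernel σ w ≤ ‖w‖ ^ (-3 - σ) :=
  Real.rpow_le_rpow_of_nonpos (norm_pos_iff.2 hw) (norm_le_spaceTimeNorm w) (by linarith)

theorem levyKernel_le_far {σ δ : ℝ} (hσ : 0 ≤ σ) (hσ' : σ ≤ 1) (hδ : 0 < δ) {w : ℝ × ℝ × ℝ}
    (hw : δ ≤ 12 * ‖w‖) :
    levyKernel σ w ≤ 15 ^ 4 * (δ + |w.1| + (|w.2.1| + |w.2.2|)) ^ (-3 - σ) := by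
  have hw0 : 0 < ‖w‖ := by linarith
  refine (levyKernel_le hσ (norm_pos_iff.1 hw0)).trans ?_
  have h1 := abs_fst_le_norm w
  have h2 := abs_snd_fst_le_norm w
  have h3 := abs_snd_snd_le_norm w
  set Q := δ + |w.1| + (|w.2.1| + |w.2.2|) with hQ
  have hQ0 : 0 < Q := by positivity
  calc ‖w‖ ^ (-3 - σ) ≤ (Q / 15) ^ (-3 - σ) :=
        Real.rpow_le_rpow_of_nonpos (by positivity) (by linarith) (by linarith)
    _ = 15 ^ (3 + σ) * Q ^ (-3 - σ) := by
        rw [Real.div_rpow hQ0.le (by norm_num), show -3 - σ = -(3 + σ) by ring,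
          Real.rpow_neg (by norm_num : (0 : ℝ) ≤ 15), div_inv_eq_mul, mul_comm]
    _ ≤ 15 ^ 4 * Q ^ (-3 - σ) := by
        gcongr
        calc (15 : ℝ) ^ (3 + σ) ≤ 15 ^ (4 : ℝ) :=
              Real.rpow_le_rpow_of_exponent_le (by norm_num) (by linarith)
          _ = 15 ^ 4 := by norm_num

theorem ofReal_norm_mul_levyKernel_le {σ : ℝ} (hσ : 0 ≤ σ) (w : ℝ × ℝ × ℝ) :
    ENNReal.ofReal (‖w‖ * levyKernel σ w) ≤ ‖w‖ₑ ^ (-2 - σ) := by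
  rcases eq_or_ne w 0 with rfl | hw
  · simp
  · have hw0 := norm_pos_iff.2 hw
    rw [← ofReal_norm, ENNReal.ofReal_rpow_of_pos hw0]
    refine ENNReal.ofReal_le_ofReal ((mul_le_mul_of_nonneg_left (levyKernel_le hσ hw)
      hw0.le).trans (le_of_eq ?_))
    rw [show -2 - σ = 1 + (-3 - σ) by ring, Real.rpow_add hw0, Real.rpow_one]

theorem exists_lintegral_coneProfile_sub_le {σ : ℝ} (hσ : 0 < σ) (hσ' : σ < 1) :
    ∃ C : ℝ, 0 ≤ C ∧ ∀ (u : ℝ) (x : Torus2), 0 < torusAbs x → |u| ≠ torusAbs x →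
      ∫⁻ w in {w : ℝ × ℝ × ℝ | ‖w‖ < 1},
          ENNReal.ofReal (|coneProfile u (torusAbs x)
            - coneProfile (u - w.1) (torusAbs (x - torusMk w.2))| * levyKernel σ w)
        ≤ ENNReal.ofReal (C * ((|u| + torusAbs x) ^ (-(1 / 2) : ℝ)
              * |(|u| - torusAbs x)| ^ (-(1 / 2) - σ)
            + torusAbs x ^ (-(1 / 2) : ℝ) * |(|u| - torusAbs x)| ^ (-(1 / 2) - σ))) := by
  obtain ⟨C₁, hC₁, h₁⟩ := exists_lintegral_enorm_rpow_le hσ.le hσ'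
  obtain ⟨C₂, hC₂, h₂⟩ := exists_lintegral_coneProfile_le hσ.le
  set C₃ : ℝ := (6 / σ) ^ 3 with hC₃d
  have hC₃ : 0 ≤ C₃ := by positivity
  refine ⟨14 * C₁ + 15 ^ 4 * C₃ + 15 ^ 4 * C₂, by positivity, fun u x hx hux => ?_⟩
  set r := torusAbs x with hr
  set δ := |(|u| - r)| with hδd
  have hδ : 0 < δ := abs_pos.2 (sub_ne_zero.2 hux)
  set W := coneProfile u r with hW
  have hW0 : 0 ≤ W := coneProfile_nonneg _ _
  have hur : 0 < |u| + r := by positivity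
  have hmp : Measurable fun w : ℝ × ℝ × ℝ =>
      coneProfile (u - w.1) (torusAbs (x - torusMk w.2)) :=
    measurable_coneProfile.comp ((measurable_const.sub measurable_fst).prodMk
      ((continuous_torusAbs.comp (continuous_const.sub continuous_torusMk)).measurable.comp
        measurable_snd))
  set E := (|u| + r) ^ (-(1 / 2) : ℝ) * δ ^ (-(3 / 2) : ℝ) with hE
  have hE0 : 0 ≤ E := by positivity
  have hpt : ∀ w : ℝ × ℝ × ℝ,
      ENNReal.ofReal (|W - coneProfile (u - w.1) (torusAbs (x - torusMk w.2))| * levyKernel σ w)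
      ≤ ENNReal.ofReal (14 * E) * (if ‖w‖ < δ then ‖w‖ₑ ^ (-2 - σ) else 0)
        + (ENNReal.ofReal (15 ^ 4 * W)
            * ENNReal.ofReal ((δ + |w.1| + (|w.2.1| + |w.2.2|)) ^ (-3 - σ))
          + ENNReal.ofReal (15 ^ 4)
            * (ENNReal.ofReal (coneProfile (u - w.1) (torusAbs (x - torusMk w.2)))
              * ENNReal.ofReal ((δ + |w.1| + (|w.2.1| + |w.2.2|)) ^ (-3 - σ)))) := by
    intro w
    have hd1 : |u - (u - w.1)| ≤ ‖w‖ := by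
      rw [sub_sub_cancel]; exact abs_fst_le_norm w
    have hd2 : |r - torusAbs (x - torusMk w.2)| ≤ 2 * ‖w‖ := by
      refine (torusAbs_sub_torusMk_le x w.2).trans ?_
      linarith [abs_snd_fst_le_norm w, abs_snd_snd_le_norm w]
    rcases le_or_gt (12 * ‖w‖) δ with h | h
    · refine le_add_right ?_
      rw [if_pos (by linarith [norm_nonneg w])]
      refine le_trans ?_ (mul_le_mul_right (ofReal_norm_mul_levyKernel_le hσ.le w) _)
      rw [← ENNReal.ofReal_mul (by positivity)]
      refine ENNReal.ofReal_le_ofReal ?_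
      refine (mul_le_mul_of_nonneg_right (abs_coneProfile_sub_le hx.le (torusAbs_nonneg _) hδ hd1
        hd2 h) (levyKernel_nonneg σ w)).trans (le_of_eq ?_)
      ring
    · refine le_add_left ?_
      set W' := coneProfile (u - w.1) (torusAbs (x - torusMk w.2)) with hW'
      have hW'0 : 0 ≤ W' := coneProfile_nonneg _ _
      rw [← ENNReal.ofReal_mul (by positivity), ← ENNReal.ofReal_mul (by positivity),
        ← ENNReal.ofReal_mul (by positivity), ← ENNReal.ofReal_add (by positivity) (by positivity)]
      refine ENNReal.ofReal_le_ofReal ?_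
      have h1 : |W - W'| ≤ W + W' := abs_le.2 ⟨by linarith, by linarith⟩
      refine (mul_le_mul h1 (levyKernel_le_far hσ.le hσ'.le hδ h.le) (levyKernel_nonneg σ w)
        (by positivity)).trans (le_of_eq ?_)
      ring
  have hmi : Measurable fun w : ℝ × ℝ × ℝ => if ‖w‖ < δ then ‖w‖ₑ ^ (-2 - σ) else 0 :=
    Measurable.ite (measurableSet_lt (by fun_prop) measurable_const) (by fun_prop)
      measurable_const
  refine (lintegral_mono hpt).trans ?_
  rw [lintegral_add_left (by fun_prop), lintegral_add_left (by fun_prop),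
    lintegral_const_mul _ hmi, lintegral_const_mul _ (by fun_prop),
    lintegral_const_mul _ (by fun_prop)]
  refine (add_le_add (mul_le_mul_right ((setLIntegral_le_lintegral _ _).trans (h₁ δ hδ)) _)
    (add_le_add (mul_le_mul_right ((setLIntegral_le_lintegral _ _).trans
      (lintegral_far_le hσ hδ)) _) (mul_le_mul_right (h₂ δ u x hδ hx) _))).trans ?_
  rw [← ENNReal.ofReal_mul (by positivity), ← ENNReal.ofReal_mul (by positivity),
    ← ENNReal.ofReal_mul (by positivity), ← ENNReal.ofReal_add (by positivity) (by positivity),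
    ← ENNReal.ofReal_add (by positivity) (by positivity)]
  refine ENNReal.ofReal_le_ofReal ?_
  have e1 : E * δ ^ (1 - σ) = (|u| + r) ^ (-(1 / 2) : ℝ) * δ ^ (-(1 / 2) - σ) := by
    rw [hE, mul_assoc, ← Real.rpow_add hδ]; congr 2; ring
  have e2 : W * δ ^ (-σ) ≤ (|u| + r) ^ (-(1 / 2) : ℝ) * δ ^ (-(1 / 2) - σ) :=
    coneProfile_mul_rpow_le hx.le
  set P := (|u| + r) ^ (-(1 / 2) : ℝ) * δ ^ (-(1 / 2) - σ) with hP
  set T := torusAbs x ^ (-(1 / 2) : ℝ) * δ ^ (-(1 / 2) - σ) with hT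
  have hP0 : 0 ≤ P := by positivity
  have hT0 : 0 ≤ T := by positivity
  calc _ = 14 * C₁ * (E * δ ^ (1 - σ)) + (15 ^ 4 * C₃ * (W * δ ^ (-σ)) + 15 ^ 4 * C₂ * T) := by
        ring
    _ ≤ 14 * C₁ * P + (15 ^ 4 * C₃ * P + 15 ^ 4 * C₂ * T) := by
        rw [e1]; gcongr
    _ ≤ _ := by
        have := mul_nonneg hC₁ hT0
        have := mul_nonneg hC₃ hT0
        have := mul_nonneg hC₂ hP0
        nlinarith

/-! ### Comparison with the majorant kernel -/

theorem one_le_japBracket (r : ℝ) : 1 ≤ japBracket r :=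
  Real.one_le_sqrt.2 (by nlinarith [sq_nonneg r])

theorem majorantKernel_nonneg (σ t s : ℝ) (x : Torus2) : 0 ≤ majorantKernel σ t s x := by
  have h1 := torusAbs_nonneg x
  have h2 : 0 ≤ japBracket t := Real.sqrt_nonneg _
  have h3 : 0 ≤ japBracket (Real.log (torusAbs x)) := Real.sqrt_nonneg _
  unfold majorantKernel
  positivity

theorem le_majorantKernel {σ t : ℝ} (hσ' : σ ≤ 1) (ht : |t| ≤ 2) (s : ℝ) (x : Torus2) :
    |t - s| ^ (-(1 / 2) - σ) * torusAbs x ^ (-(1 / 2) : ℝ)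
      + (|t - s| + torusAbs x) ^ (-(1 / 2) : ℝ) * |(|t - s| - torusAbs x)| ^ (-(1 / 2) - σ)
      ≤ 81 * majorantKernel σ t s x := by
  have hx := torusAbs_nonneg x
  unfold majorantKernel
  set P := |t - s| ^ (-(1 / 2) - σ) * torusAbs x ^ (-(1 / 2) : ℝ) with hP
  set Q := (|t - s| + torusAbs x) ^ (-(1 / 2) : ℝ) * |(|t - s| - torusAbs x)| ^ (-(1 / 2) - σ)
    with hQ
  have hP0 : 0 ≤ P := by positivity
  have hQ0 : 0 ≤ Q := by positivity
  have hb : 1 ≤ 81 * japBracket t ^ (-3 - σ) := by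
    have h1 : japBracket t ≤ 3 := by
      rw [japBracket, Real.sqrt_le_left (by norm_num)]
      nlinarith [abs_le.1 ht]
    have h2 : (3 : ℝ) ^ (-4 : ℝ) ≤ japBracket t ^ (-3 - σ) :=
      calc (3 : ℝ) ^ (-4 : ℝ) ≤ japBracket t ^ (-4 : ℝ) :=
            Real.rpow_le_rpow_of_nonpos (by linarith [one_le_japBracket t]) h1 (by norm_num)
        _ ≤ japBracket t ^ (-3 - σ) :=
            Real.rpow_le_rpow_of_exponent_le (one_le_japBracket t) (by linarith)
    have h3 : (3 : ℝ) ^ (-4 : ℝ) = 1 / 81 := by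
      rw [Real.rpow_neg (by norm_num)]; norm_num
    rw [h3] at h2; linarith
  have hl1 := one_le_pow₀ (one_le_japBracket (Real.log |(|t - s| - torusAbs x)|)) (n := 2)
  have hl2 := one_le_pow₀ (one_le_japBracket (Real.log (torusAbs x))) (n := 3)
  calc P + Q ≤ 1 + P + Q := by linarith
    _ = 1 * (1 + P + Q) * 1 * 1 := by ring
    _ ≤ (81 * japBracket t ^ (-3 - σ)) * (1 + P + Q)
        * japBracket (Real.log |(|t - s| - torusAbs x)|) ^ 2
        * japBracket (Real.log (torusAbs x)) ^ 3 := by gcongr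
    _ = _ := by ring

theorem rpow_mul_rpow_le_add {σ u r : ℝ} (hσ : 0 ≤ σ) (hσ' : σ < 1 / 2) (hr : 0 < r) :
    r ^ (-(1 / 2) : ℝ) * |(|u| - r)| ^ (-(1 / 2) - σ)
      ≤ 2 * (|u| ^ (-(1 / 2) - σ) * r ^ (-(1 / 2) : ℝ)
        + (|u| + r) ^ (-(1 / 2) : ℝ) * |(|u| - r)| ^ (-(1 / 2) - σ)) := by
  have h2 : ∀ c : ℝ, 0 < c → c ≤ 4 → ∀ y : ℝ, 0 < y → ∀ z, y / c ≤ z → ∀ a : ℝ, a ≤ 1 → 0 ≤ a →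
      (a ≤ 1 / 2 ∨ c ≤ 2) → z ^ (-a) ≤ 2 * y ^ (-a) := by
    intro c hc hc4 y hy z hz a ha ha0 hca
    calc z ^ (-a) ≤ (y / c) ^ (-a) :=
          Real.rpow_le_rpow_of_nonpos (by positivity) hz (by linarith)
      _ = c ^ a * y ^ (-a) := by
          rw [Real.div_rpow hy.le hc.le, Real.rpow_neg hc.le, div_inv_eq_mul, mul_comm]
      _ ≤ 2 * y ^ (-a) := by
          gcongr
          rcases hca with h | h
          · calc c ^ a ≤ 4 ^ a := Real.rpow_le_rpow hc.le hc4 ha0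
              _ ≤ 4 ^ (1 / 2 : ℝ) := Real.rpow_le_rpow_of_exponent_le (by norm_num) h
              _ = 2 := by
                rw [← Real.sqrt_eq_rpow, show (4 : ℝ) = 2 ^ 2 by norm_num]
                exact Real.sqrt_sq zero_le_two
          · calc c ^ a ≤ 2 ^ a := Real.rpow_le_rpow hc.le h ha0
              _ ≤ 2 ^ (1 : ℝ) := Real.rpow_le_rpow_of_exponent_le (by norm_num) ha
              _ = 2 := Real.rpow_one 2
  have hu0 := abs_nonneg u
  rcases le_or_gt (|u|) (2 * r) with h | h
  · have := h2 3 (by norm_num) (by norm_num) (|u| + r) (by positivity) r (by linarith) (1 / 2)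
      (by norm_num) (by norm_num) (Or.inl le_rfl)
    calc _ ≤ (2 * (|u| + r) ^ (-(1 / 2) : ℝ)) * |(|u| - r)| ^ (-(1 / 2) - σ) := by gcongr
      _ ≤ _ := by
        have : 0 ≤ |u| ^ (-(1 / 2) - σ) * r ^ (-(1 / 2) : ℝ) := by positivity
        linarith
  · have := h2 2 (by norm_num) (by norm_num) |u| (by linarith) |(|u| - r)|
      ((by linarith : |u| / 2 ≤ |u| - r).trans (le_abs_self _)) (1 / 2 + σ)
      (by linarith) (by linarith) (Or.inr le_rfl)
    rw [neg_add'] at this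
    calc _ ≤ r ^ (-(1 / 2) : ℝ) * (2 * |u| ^ (-(1 / 2) - σ)) := by gcongr
      _ ≤ _ := by
        have : 0 ≤ (|u| + r) ^ (-(1 / 2) : ℝ) * |(|u| - r)| ^ (-(1 / 2) - σ) := by positivity
        linarith

theorem exists_abs_dampedWaveKernel_le {χ : ℝ → ℝ} (hχ : ContDiff ℝ ∞ χ)
    (hsupp : tsupport χ ⊆ Set.Icc (-1) 1) {σ : ℝ} (hσ : 0 ≤ σ) (hσ' : σ < 1 / 2) :
    ∃ C : ℝ, 0 ≤ C ∧ ∀ t s x, |dampedWaveKernel χ t s x| ≤ C * majorantKernel σ t s x := by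
  obtain ⟨A, hA, hA1, -⟩ := exists_outerCutoff_bound hχ hsupp
  refine ⟨324 * A, by positivity, fun t s x => ?_⟩
  have hR := majorantKernel_nonneg σ t s x
  rw [dampedWaveKernel_eq hsupp]
  by_cases ht : t ∈ Set.Icc (-1 : ℝ) 1
  swap
  · rw [outerCutoff_of_notMem_Icc hsupp ht]; simp; positivity
  by_cases hs : s ∈ Set.Icc (0 : ℝ) 1
  swap
  · rw [innerCutoff_of_notMem hs]; simp; positivity
  have hu : |t - s| ≤ 3 := abs_le.2 ⟨by linarith [ht.1, hs.2], by linarith [ht.2, hs.1]⟩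
  have h1 := coneProfile_le (torusAbs_nonneg x) hu hσ hσ'
  have h2 := le_majorantKernel (σ := σ) (by linarith) (abs_le.2 ⟨by linarith [ht.1], by linarith [ht.2]⟩ : |t| ≤ 2) s x
  have h3 : 0 ≤ |t - s| ^ (-(1 / 2) - σ) * torusAbs x ^ (-(1 / 2) : ℝ) := by
    have := torusAbs_nonneg x
    positivity
  rw [abs_mul, abs_mul, abs_of_nonneg (innerCutoff_nonneg s), abs_of_nonneg (coneProfile_nonneg _ _)]
  calc _ ≤ 2 * (A * (162 * majorantKernel σ t s x)) := by
        refine mul_le_mul (innerCutoff_le_two s) ?_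
          (mul_nonneg (abs_nonneg _) (coneProfile_nonneg _ _)) zero_le_two
        exact mul_le_mul (hA1 t) (by linarith) (coneProfile_nonneg _ _) hA
    _ = _ := by ring

theorem exists_lintegral_dampedWaveKernel_sub_le {χ : ℝ → ℝ} (hχ : ContDiff ℝ ∞ χ)
    (hsupp : tsupport χ ⊆ Set.Icc (-1) 1) {σ : ℝ} (hσ : 0 < σ) (hσ' : σ < 1 / 2) :
    ∃ C : ℝ, 0 ≤ C ∧ ∀ (t s : ℝ) (x : Torus2), 0 < torusAbs x → |t - s| ≠ torusAbs x →
      ∫⁻ w in {w : ℝ × ℝ × ℝ | ‖w‖ < 1},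
          ENNReal.ofReal (|dampedWaveKernel χ t s x
            - dampedWaveKernel χ (t - w.1) s (x - torusMk w.2)| * levyKernel σ w)
        ≤ ENNReal.ofReal (C * majorantKernel σ t s x) := by
  obtain ⟨A, hA, hA1, hA2⟩ := exists_outerCutoff_bound hχ hsupp
  obtain ⟨C₁, hC₁, h₁⟩ := exists_lintegral_coneProfile_sub_le hσ (by linarith)
  obtain ⟨C₂, hC₂, h₂⟩ := exists_lintegral_enorm_rpow_le hσ.le (by linarith : σ < 1)
  refine ⟨2 * A * (C₁ * (3 * 81) + 162 * C₂), by positivity, fun t s x hx htx => ?_⟩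
  set D : Set (ℝ × ℝ × ℝ) := {w | ‖w‖ < 1} with hD
  have hDm : MeasurableSet D := measurableSet_lt (by fun_prop) measurable_const
  simp_rw [dampedWaveKernel_eq hsupp]
  by_cases hts : t ∈ Set.Icc (-2 : ℝ) 2 ∧ s ∈ Set.Icc (0 : ℝ) 1
  swap
  · refine le_trans (le_of_eq ?_) zero_le
    rw [setLIntegral_congr_fun (g := fun _ => 0) hDm, lintegral_zero]
    intro w hw
    have hw1 := abs_lt.1 ((abs_fst_le_norm w).trans_lt hw)
    by_cases hs : s ∈ Set.Icc (0 : ℝ) 1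
    · have ht : t ∉ Set.Icc (-2 : ℝ) 2 := fun ht => hts ⟨ht, hs⟩
      have e1 : outerCutoff χ t = 0 := outerCutoff_of_notMem_Icc hsupp fun h =>
        ht ⟨by linarith [h.1], by linarith [h.2]⟩
      have e2 : outerCutoff χ (t - w.1) = 0 := outerCutoff_of_notMem_Icc hsupp fun h =>
        ht ⟨by linarith [h.1], by linarith [h.2]⟩
      simp [e1, e2]
    · simp [innerCutoff_of_notMem hs]
  obtain ⟨ht, hs⟩ := hts
  have hu : |t - s| ≤ 3 := abs_le.2 ⟨by linarith [ht.1, hs.2], by linarith [ht.2, hs.1]⟩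
  have hW := coneProfile_le (torusAbs_nonneg x) hu hσ.le hσ'
  have hR := le_majorantKernel (σ := σ) (by linarith) (abs_le.2 ⟨ht.1, ht.2⟩) s x
  have hT := rpow_mul_rpow_le_add (u := t - s) hσ.le hσ' hx
  have hint := h₁ (t - s) x hx htx
  set R := majorantKernel σ t s x
  set W := coneProfile (t - s) (torusAbs x) with hWd
  have hW0 : 0 ≤ W := coneProfile_nonneg _ _
  set P := (|t - s| + torusAbs x) ^ (-(1 / 2) : ℝ) * |(|t - s| - torusAbs x)| ^ (-(1 / 2) - σ)
    with hP
  set Q := |t - s| ^ (-(1 / 2) - σ) * torusAbs x ^ (-(1 / 2) : ℝ) with hQ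
  set T := torusAbs x ^ (-(1 / 2) : ℝ) * |(|t - s| - torusAbs x)| ^ (-(1 / 2) - σ) with hTd
  have hP0 : 0 ≤ P := by positivity
  have hQ0 : 0 ≤ Q := by positivity
  have hT0 : 0 ≤ T := by positivity
  have hpt : ∀ w ∈ D, ENNReal.ofReal (|innerCutoff s * (outerCutoff χ t * W)
        - innerCutoff s * (outerCutoff χ (t - w.1)
          * coneProfile (t - w.1 - s) (torusAbs (x - torusMk w.2)))| * levyKernel σ w)
      ≤ ENNReal.ofReal (2 * A) * ENNReal.ofReal (|W
          - coneProfile (t - s - w.1) (torusAbs (x - torusMk w.2))| * levyKernel σ w)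
        + ENNReal.ofReal (2 * A * W) * (if ‖w‖ < 1 then ‖w‖ₑ ^ (-2 - σ) else 0) := by
    intro w hw
    have hw' : ‖w‖ < 1 := hw
    rw [if_pos hw', sub_right_comm t w.1 s]
    refine le_trans ?_ (add_le_add_right (mul_le_mul_right
      (ofReal_norm_mul_levyKernel_le hσ.le w) _) _)
    have hJ := levyKernel_nonneg σ w
    rw [← ENNReal.ofReal_mul (by positivity), ← ENNReal.ofReal_mul (by positivity),
      ← ENNReal.ofReal_add (by positivity) (by positivity)]
    refine ENNReal.ofReal_le_ofReal ?_
    set W' := coneProfile (t - s - w.1) (torusAbs (x - torusMk w.2)) with hW'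
    have e : innerCutoff s * (outerCutoff χ t * W) - innerCutoff s * (outerCutoff χ (t - w.1) * W')
        = innerCutoff s * (outerCutoff χ (t - w.1) * (W - W')
          + (outerCutoff χ t - outerCutoff χ (t - w.1)) * W) := by ring
    have hb : |outerCutoff χ t - outerCutoff χ (t - w.1)| ≤ A * ‖w‖ := by
      refine (hA2 _ _).trans ?_
      rw [sub_sub_cancel]
      exact mul_le_mul_of_nonneg_left (abs_fst_le_norm w) hA
    have hmain : |outerCutoff χ (t - w.1) * (W - W')
          + (outerCutoff χ t - outerCutoff χ (t - w.1)) * W| ≤ A * |W - W'| + A * ‖w‖ * W := by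
      refine (abs_add_le _ _).trans ?_
      rw [abs_mul, abs_mul, abs_of_nonneg hW0]
      gcongr
      exact hA1 _
    rw [e, abs_mul, abs_of_nonneg (innerCutoff_nonneg s)]
    calc _ ≤ 2 * (A * |W - W'| + A * ‖w‖ * W) * levyKernel σ w := by
          gcongr
          exact innerCutoff_le_two s
      _ = _ := by ring
  have hmi : Measurable fun w : ℝ × ℝ × ℝ => if ‖w‖ < 1 then ‖w‖ₑ ^ (-2 - σ) else 0 :=
    Measurable.ite hDm (by fun_prop) measurable_const
  refine (setLIntegral_mono' hDm hpt).trans ?_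
  rw [lintegral_add_right _ (hmi.const_mul _), lintegral_const_mul' _ _ ENNReal.ofReal_ne_top,
    lintegral_const_mul _ hmi]
  refine (add_le_add (mul_le_mul_right hint _) (mul_le_mul_right
    ((setLIntegral_le_lintegral _ _).trans (h₂ 1 one_pos)) _)).trans ?_
  rw [← ENNReal.ofReal_mul (by positivity), ← ENNReal.ofReal_mul (by positivity),
      ← ENNReal.ofReal_add (by positivity) (by positivity), Real.one_rpow, mul_one]
  refine ENNReal.ofReal_le_ofReal ?_
  have h5 : P + T ≤ 3 * 81 * R := by linarith
  have h6 : W ≤ 162 * R := by linarith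
  calc 2 * A * (C₁ * (P + T)) + 2 * A * W * C₂
      ≤ 2 * A * (C₁ * (3 * 81 * R)) + 2 * A * (162 * R) * C₂ := by gcongr
    _ = _ := by ring

/-! ### The symbol of the fractional Laplacian -/

section Symbol

variable {E : Type*} [NormedAddCommGroup E] [InnerProductSpace ℝ E] [FiniteDimensional ℝ E]
  [MeasurableSpace E] [BorelSpace E]

theorem integral_one_sub_cexp_inner_comp_isometry (T : E ≃ₗᵢ[ℝ] E) (a : ℝ) (ξ : E) :
    ∫ w : E, (1 - Complex.exp (-(Complex.I * (inner ℝ (T ξ) w : ℝ)))) * ((‖w‖ ^ a : ℝ) : ℂ)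
      = ∫ w : E, (1 - Complex.exp (-(Complex.I * (inner ℝ ξ w : ℝ)))) * ((‖w‖ ^ a : ℝ) : ℂ) := by
  rw [← T.measurePreserving.integral_comp T.toHomeomorph.measurableEmbedding]
  simp only [LinearIsometryEquiv.inner_map_map, LinearIsometryEquiv.norm_map]

theorem integral_one_sub_cexp_inner_smul (σ : ℝ) {r : ℝ} (hr : 0 < r) (ξ : E) :
    ∫ w : E, (1 - Complex.exp (-(Complex.I * (inner ℝ (r • ξ) w : ℝ))))
        * ((‖w‖ ^ (-(Module.finrank ℝ E : ℝ) - σ) : ℝ) : ℂ)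
      = ((r ^ σ : ℝ) : ℂ) * ∫ w : E, (1 - Complex.exp (-(Complex.I * (inner ℝ ξ w : ℝ))))
        * ((‖w‖ ^ (-(Module.finrank ℝ E : ℝ) - σ) : ℝ) : ℂ) := by
  set d : ℝ := (Module.finrank ℝ E : ℝ) with hd
  let G : E → ℂ := fun w => (1 - Complex.exp (-(Complex.I * (inner ℝ ξ w : ℝ))))
    * ((‖w‖ ^ (-d - σ) : ℝ) : ℂ)
  have h1 : ∀ w : E, (1 - Complex.exp (-(Complex.I * (inner ℝ (r • ξ) w : ℝ))))
        * ((‖w‖ ^ (-d - σ) : ℝ) : ℂ) = ((r ^ (d + σ) : ℝ) : ℂ) * G (r • w) := fun w => by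
    simp only [G]
    rw [real_inner_smul_left, real_inner_smul_right, norm_smul, Real.norm_of_nonneg hr.le,
      Real.mul_rpow hr.le (norm_nonneg _), mul_left_comm, ← Complex.ofReal_mul, ← mul_assoc,
      ← Real.rpow_add hr]
    simp
  simp_rw [h1]
  rw [integral_const_mul, Measure.integral_comp_smul, Complex.real_smul, ← mul_assoc,
    ← Complex.ofReal_mul]
  congr 2
  rw [abs_of_pos (by positivity), ← Real.rpow_natCast, ← hd, ← Real.rpow_neg hr.le,
    ← Real.rpow_add hr]
  congr 1; ring

theorem integral_one_sub_cexp_inner_eq {σ : ℝ} (hσ : 0 < σ) {e : E} (he : ‖e‖ = 1) (ξ : E) :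
    ∫ w : E, (1 - Complex.exp (-(Complex.I * (inner ℝ ξ w : ℝ))))
        * ((‖w‖ ^ (-(Module.finrank ℝ E : ℝ) - σ) : ℝ) : ℂ)
      = ((‖ξ‖ ^ σ : ℝ) : ℂ) * ∫ w : E, (1 - Complex.exp (-(Complex.I * (inner ℝ e w : ℝ))))
        * ((‖w‖ ^ (-(Module.finrank ℝ E : ℝ) - σ) : ℝ) : ℂ) := by
  rcases eq_or_ne ξ 0 with rfl | hξ
  · simp [Real.zero_rpow hσ.ne']
  have hr := norm_pos_iff.2 hξ
  have h : ‖‖ξ‖ • e‖ = ‖ξ‖ := by rw [norm_smul, he, mul_one, norm_norm]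
  rw [← integral_one_sub_cexp_inner_smul σ hr, ← integral_one_sub_cexp_inner_comp_isometry
    (Submodule.reflection (Submodule.span ℝ {‖ξ‖ • e - ξ})ᗮ) _ (‖ξ‖ • e), Submodule.reflection_sub h]

end Symbol

/-- The phase `τ t + n · x`. -/
noncomputable def phase (ξ w : ℝ × ℝ × ℝ) : ℝ := ξ.1 * w.1 + (ξ.2.1 * w.2.1 + ξ.2.2 * w.2.2)

theorem setLIntegral_levyKernel_lt_top {σ : ℝ} (hσ : 0 < σ) (hσ' : σ < 1) :
    ∫⁻ w in {w : ℝ × ℝ × ℝ | ‖w‖ < 1}ᶜ, ENNReal.ofReal (levyKernel σ w) < ⊤ := by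
  have hDm : MeasurableSet {w : ℝ × ℝ × ℝ | ‖w‖ < 1}ᶜ :=
    (measurableSet_lt (by fun_prop) measurable_const).compl
  calc ∫⁻ w in {w : ℝ × ℝ × ℝ | ‖w‖ < 1}ᶜ, ENNReal.ofReal (levyKernel σ w)
      ≤ ∫⁻ w in {w : ℝ × ℝ × ℝ | ‖w‖ < 1}ᶜ, ENNReal.ofReal (15 ^ 4)
        * ENNReal.ofReal ((1 + |w.1| + (|w.2.1| + |w.2.2|)) ^ (-3 - σ)) := by
        refine setLIntegral_mono' hDm fun w hw => ?_
        have hw' : 1 ≤ ‖w‖ := not_lt.1 hw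
        rw [← ENNReal.ofReal_mul (by positivity)]
        exact ENNReal.ofReal_le_ofReal (levyKernel_le_far hσ.le hσ'.le one_pos (by linarith))
    _ ≤ ∫⁻ w : ℝ × ℝ × ℝ, ENNReal.ofReal (15 ^ 4)
        * ENNReal.ofReal ((1 + |w.1| + (|w.2.1| + |w.2.2|)) ^ (-3 - σ)) :=
        setLIntegral_le_lintegral _ _
    _ < ⊤ := by
        rw [lintegral_const_mul _ (by fun_prop)]
        exact ENNReal.mul_lt_top ENNReal.ofReal_lt_top
          ((lintegral_far_le hσ one_pos).trans_lt ENNReal.ofReal_lt_top)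

theorem abs_phase_le (ξ w : ℝ × ℝ × ℝ) : |phase ξ w| ≤ 3 * ‖ξ‖ * ‖w‖ := by
  have h1 := mul_le_mul (abs_fst_le_norm ξ) (abs_fst_le_norm w) (abs_nonneg _) (norm_nonneg _)
  have h2 := mul_le_mul (abs_snd_fst_le_norm ξ) (abs_snd_fst_le_norm w) (abs_nonneg _)
    (norm_nonneg _)
  have h3 := mul_le_mul (abs_snd_snd_le_norm ξ) (abs_snd_snd_le_norm w) (abs_nonneg _)
    (norm_nonneg _)
  rw [← abs_mul] at h1 h2 h3
  refine (abs_add_le _ _).trans ?_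
  linarith [abs_add_le (ξ.2.1 * w.2.1) (ξ.2.2 * w.2.2)]

theorem measurable_one_sub_cexp_phase (ξ : ℝ × ℝ × ℝ) :
    Measurable fun w => 1 - Complex.exp (-(Complex.I * (phase ξ w : ℂ))) := by
  unfold phase; fun_prop

theorem integrable_one_sub_cexp_phase {σ : ℝ} (hσ : 0 < σ) (hσ' : σ < 1) (ξ : ℝ × ℝ × ℝ) :
    Integrable (fun w => (1 - Complex.exp (-(Complex.I * (phase ξ w : ℂ))))
      * (levyKernel σ w : ℂ)) := by
  have hDm : MeasurableSet {w : ℝ × ℝ × ℝ | ‖w‖ < 1} :=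
    measurableSet_lt (by fun_prop) measurable_const
  obtain ⟨C, -, hC⟩ := exists_lintegral_enorm_rpow_le hσ.le hσ'
  refine ⟨((measurable_one_sub_cexp_phase ξ).mul
    (measurable_levyKernel σ).complex_ofReal).aestronglyMeasurable, ?_⟩
  rw [HasFiniteIntegral, ← lintegral_add_compl _ hDm]
  have hn : ∀ w, ‖(1 - Complex.exp (-(Complex.I * (phase ξ w : ℂ)))) * (levyKernel σ w : ℂ)‖ₑ
      = ENNReal.ofReal (‖1 - Complex.exp (-(Complex.I * (phase ξ w : ℂ)))‖ * levyKernel σ w) :=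
    fun w => by
      rw [← ofReal_norm, norm_mul, Complex.norm_real, Real.norm_of_nonneg (levyKernel_nonneg σ w)]
  have hexp : ∀ w, -(Complex.I * (phase ξ w : ℂ)) = Complex.I * ((-phase ξ w : ℝ) : ℂ) :=
    fun w => by push_cast; ring
  simp_rw [hn]
  refine ENNReal.add_lt_top.2 ⟨?_, ?_⟩
  · calc _ ≤ ∫⁻ w in {w : ℝ × ℝ × ℝ | ‖w‖ < 1}, ENNReal.ofReal (3 * ‖ξ‖)
          * (if ‖w‖ < 1 then ‖w‖ₑ ^ (-2 - σ) else 0) := by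
          refine setLIntegral_mono' hDm fun w hw => ?_
          have hw' : ‖w‖ < 1 := hw
          rw [if_pos hw']
          refine le_trans ?_ (mul_le_mul_right (ofReal_norm_mul_levyKernel_le hσ.le w) _)
          rw [← ENNReal.ofReal_mul (by positivity), ← mul_assoc]
          refine ENNReal.ofReal_le_ofReal (mul_le_mul_of_nonneg_right ?_ (levyKernel_nonneg σ w))
          rw [norm_sub_rev, hexp]
          refine Real.norm_exp_I_mul_ofReal_sub_one_le.trans ?_
          rw [norm_neg]
          exact abs_phase_le ξ w
      _ ≤ ∫⁻ w, ENNReal.ofReal (3 * ‖ξ‖)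
          * (if ‖w‖ < 1 then ‖w‖ₑ ^ (-2 - σ) else 0) := setLIntegral_le_lintegral _ _
      _ < ⊤ := by
          rw [lintegral_const_mul' _ _ ENNReal.ofReal_ne_top]
          exact ENNReal.mul_lt_top ENNReal.ofReal_lt_top
            ((hC 1 one_pos).trans_lt ENNReal.ofReal_lt_top)
  · calc _ ≤ ∫⁻ w in {w : ℝ × ℝ × ℝ | ‖w‖ < 1}ᶜ, 2 * ENNReal.ofReal (levyKernel σ w) := by
          refine lintegral_mono fun w => ?_
          rw [← ENNReal.ofReal_ofNat, ← ENNReal.ofReal_mul zero_le_two]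
          refine ENNReal.ofReal_le_ofReal (mul_le_mul_of_nonneg_right ?_ (levyKernel_nonneg σ w))
          refine (norm_sub_le _ _).trans ?_
          rw [hexp, Complex.norm_exp_I_mul_ofReal, norm_one]
          norm_num
      _ < ⊤ := by
          rw [lintegral_const_mul' _ _ (by simp)]
          exact ENNReal.mul_lt_top (by simp) (setLIntegral_levyKernel_lt_top hσ hσ')

theorem exists_levy_symbol {σ : ℝ} (hσ : 0 < σ) (hσ' : σ < 1) :
    ∃ c : ℂ, c ≠ 0 ∧ ∀ ξ : ℝ × ℝ × ℝ,
      ∫ w, (1 - Complex.exp (-(Complex.I * (phase ξ w : ℂ)))) * (levyKernel σ w : ℂ)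
        = ((spaceTimeNorm ξ ^ σ : ℝ) : ℂ) * c := by
  let e₀ : ℝ × ℝ × ℝ := (1, 0, 0)
  refine ⟨∫ w, (1 - Complex.exp (-(Complex.I * (phase e₀ w : ℂ)))) * (levyKernel σ w : ℂ),
    fun h => ?_, fun ξ => ?_⟩
  · have hint := integrable_one_sub_cexp_phase hσ hσ' e₀
    have hre : ∀ w, ((1 - Complex.exp (-(Complex.I * (phase e₀ w : ℂ)))) * (levyKernel σ w : ℂ)).re
        = (1 - Real.cos w.1) * levyKernel σ w := fun w => by
      rw [Complex.re_mul_ofReal, Complex.sub_re, Complex.one_re, Complex.exp_re]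
      simp [phase, e₀]
    have h0 : ∫ w : ℝ × ℝ × ℝ, (1 - Real.cos w.1) * levyKernel σ w = 0 := by
      simp_rw [← hre]
      have := integral_re hint
      simp only [RCLike.re_eq_complex_re] at this
      rw [this, h]; simp
    have hintr : Integrable fun w : ℝ × ℝ × ℝ => (1 - Real.cos w.1) * levyKernel σ w := by
      simp_rw [← hre]; exact hint.re
    have hpos : 0 < ∫ w : ℝ × ℝ × ℝ, (1 - Real.cos w.1) * levyKernel σ w := by
      rw [integral_pos_iff_support_of_nonneg (fun w => mul_nonneg
        (sub_nonneg.2 (Real.cos_le_one _)) (levyKernel_nonneg σ w)) hintr]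
      have hopen : IsOpen {w : ℝ × ℝ × ℝ | 0 < w.1 ∧ w.1 < π} :=
        (isOpen_lt continuous_const continuous_fst).inter
          (isOpen_lt continuous_fst continuous_const)
      refine (hopen.measure_pos volume ⟨(1, 0, 0), by norm_num, by
        have := Real.pi_gt_three; simp only; linarith⟩).trans_le (measure_mono fun w hw => ?_)
      have hw0 : w ≠ 0 := fun h => hw.1.ne' (by rw [h]; rfl)
      have hn : 0 < spaceTimeNorm w := (norm_pos_iff.2 hw0).trans_le (norm_le_spaceTimeNorm w)
      have hc : Real.cos w.1 < 1 := by
        have := Real.cos_lt_cos_of_nonneg_of_le_pi le_rfl hw.2.le hw.1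
        rwa [Real.cos_zero] at this
      exact (mul_pos (sub_pos.2 hc) (Real.rpow_pos_of_pos hn _)).ne'
    exact hpos.ne' h0
  · let E := WithLp 2 (ℝ × WithLp 2 (ℝ × ℝ))
    let Ψ : E → ℝ × ℝ × ℝ := fun z => (z.fst, z.snd.ofLp)
    have hΨ : MeasurePreserving Ψ :=
      ((MeasurePreserving.id (volume : Measure ℝ)).prod
        (WithLp.volume_preserving_ofLp (U := ℝ) (V := ℝ))).comp
        (WithLp.volume_preserving_ofLp (U := ℝ) (V := WithLp 2 (ℝ × ℝ)))
    let Θ : ℝ × ℝ × ℝ → E := fun w => WithLp.toLp 2 (w.1, WithLp.toLp 2 w.2)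
    have hemb : MeasurableEmbedding Ψ := by
      let H : E ≃ₜ ℝ × ℝ × ℝ :=
        { toFun := Ψ
          invFun := Θ
          left_inv := fun _ => rfl
          right_inv := fun _ => rfl
          continuous_toFun := by fun_prop
          continuous_invFun := by fun_prop }
      exact H.measurableEmbedding
    have hfin : Module.finrank ℝ E = 3 := by
      let L : E ≃ₗ[ℝ] ℝ × ℝ × ℝ :=
        { toFun := Ψ
          invFun := Θ
          left_inv := fun _ => rfl
          right_inv := fun _ => rfl
          map_add' := fun _ _ => rfl
          map_smul' := fun _ _ => rfl }
      rw [L.finrank_eq]; simp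
    have hnorm : ∀ z : E, ‖z‖ = spaceTimeNorm (Ψ z) := fun z => by
      rw [WithLp.prod_norm_eq_of_L2, WithLp.prod_norm_sq_eq_of_L2]
      simp only [spaceTimeNorm, Ψ, Real.norm_eq_abs, sq_abs]
      rfl
    have hinner : ∀ (ξ : ℝ × ℝ × ℝ) (z : E), inner ℝ (Θ ξ) z = phase ξ (Ψ z) := fun ξ z => by
      have hreal : ∀ a b : ℝ, inner ℝ a b = a * b := fun a b => by simp [mul_comm]
      refine (WithLp.prod_inner_apply (𝕜 := ℝ) (E := ℝ) (F := WithLp 2 (ℝ × ℝ)) (Θ ξ) z).trans ?_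
      refine (congrArg₂ (· + ·) (hreal _ _) (WithLp.prod_inner_apply _ _)).trans ?_
      simp only [hreal]
      rfl
    have key : ∀ ξ : ℝ × ℝ × ℝ,
        ∫ w, (1 - Complex.exp (-(Complex.I * (phase ξ w : ℂ)))) * (levyKernel σ w : ℂ)
        = ∫ z : E, (1 - Complex.exp (-(Complex.I * (inner ℝ (Θ ξ) z : ℝ))))
          * ((‖z‖ ^ (-(Module.finrank ℝ E : ℝ) - σ) : ℝ) : ℂ) := fun ξ => by
      rw [← hΨ.integral_comp hemb]
      simp_rw [hnorm, hinner, hfin]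
      rfl
    have hΨΘ : ∀ ξ, Ψ (Θ ξ) = ξ := fun ξ => rfl
    rw [key, key, integral_one_sub_cexp_inner_eq hσ (e := Θ e₀) _ (Θ ξ), hnorm, hΨΘ]
    rw [hnorm, hΨΘ]
    simp [spaceTimeNorm, e₀]

/-! ### The fractional Laplacian as a singular integral -/

instance isAddLeftInvariant_volume_torus : (volume : Measure Torus2).IsAddLeftInvariant :=
  Measure.prod.instIsAddLeftInvariant (μ := (volume : Measure (AddCircle (2 * π))))
    (ν := (volume : Measure (AddCircle (2 * π))))

instance isAddLeftInvariant_volume_spaceTime :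
    (volume : Measure (ℝ × Torus2)).IsAddLeftInvariant :=
  Measure.prod.instIsAddLeftInvariant (μ := (volume : Measure ℝ)) (ν := (volume : Measure Torus2))

/-- The projection of `ℝ × ℝ²` onto `ℝ × 𝕋²`. -/
noncomputable def spaceTimeMk (w : ℝ × ℝ × ℝ) : ℝ × Torus2 := (w.1, torusMk w.2)

theorem continuous_spaceTimeMk : Continuous spaceTimeMk :=
  continuous_fst.prodMk (continuous_torusMk.comp continuous_snd)

/-- The character `(t, x) ↦ e^{-i(τt + n·x)}` of `ℝ × 𝕋²`. -/
noncomputable def spaceTimeChar (τ : ℝ) (n : ℤ × ℤ) (z : ℝ × Torus2) : ℂ :=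
  Complex.exp (-(Complex.I * ((τ * z.1 : ℝ) : ℂ))) * fourier (-n.1) z.2.1 * fourier (-n.2) z.2.2

theorem continuous_spaceTimeChar (τ : ℝ) (n : ℤ × ℤ) : Continuous (spaceTimeChar τ n) := by
  unfold spaceTimeChar; fun_prop

theorem norm_spaceTimeChar (τ : ℝ) (n : ℤ × ℤ) (z : ℝ × Torus2) : ‖spaceTimeChar τ n z‖ = 1 := by
  have h : -(Complex.I * ((τ * z.1 : ℝ) : ℂ)) = Complex.I * ((-(τ * z.1) : ℝ) : ℂ) := by
    push_cast; ring
  rw [spaceTimeChar, norm_mul, norm_mul, h, Complex.norm_exp_I_mul_ofReal, fourier_apply,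
    fourier_apply, Circle.norm_coe, Circle.norm_coe]
  norm_num

theorem spaceTimeChar_add_mk (τ : ℝ) (n : ℤ × ℤ) (z : ℝ × Torus2) (w : ℝ × ℝ × ℝ) :
    spaceTimeChar τ n (z + spaceTimeMk w)
      = Complex.exp (-(Complex.I * (phase (τ, n.1, n.2) w : ℂ))) * spaceTimeChar τ n z := by
  have hf : ∀ (k : ℤ) (a : AddCircle (2 * π)) (v : ℝ),
      (fourier (-k) (a + (v : AddCircle (2 * π))) : ℂ)
        = fourier (-k) a * Complex.exp (-(Complex.I * ((k * v : ℝ) : ℂ))) := by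
    intro k a v
    have h1 : (fourier (-k) (a + (v : AddCircle (2 * π))) : ℂ)
        = fourier (-k) a * fourier (-k) (v : AddCircle (2 * π)) := by
      simp only [fourier_apply, smul_add, AddCircle.toCircle_add, Circle.coe_mul]
    rw [h1, fourier_coe_apply]
    congr 2
    have : (π : ℂ) ≠ 0 := by exact_mod_cast Real.pi_ne_zero
    push_cast
    field_simp
  simp only [spaceTimeChar, spaceTimeMk, torusMk, Prod.fst_add, Prod.snd_add, hf]
  have e : Complex.exp (-(Complex.I * ((τ * (z.1 + w.1) : ℝ) : ℂ)))
      = Complex.exp (-(Complex.I * ((τ * z.1 : ℝ) : ℂ)))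
        * Complex.exp (-(Complex.I * ((τ * w.1 : ℝ) : ℂ))) := by
    rw [← Complex.exp_add]; congr 1; push_cast; ring
  have e' : Complex.exp (-(Complex.I * (phase (τ, n.1, n.2) w : ℂ)))
      = Complex.exp (-(Complex.I * ((τ * w.1 : ℝ) : ℂ)))
        * (Complex.exp (-(Complex.I * ((n.1 * w.2.1 : ℝ) : ℂ)))
          * Complex.exp (-(Complex.I * ((n.2 * w.2.2 : ℝ) : ℂ)))) := by
    rw [← Complex.exp_add, ← Complex.exp_add]; congr 1; simp only [phase]; push_cast; ring
  rw [e, e']; ring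

theorem spaceTimeFourier_eq (u : ℝ × Torus2 → ℂ) (τ : ℝ) (n : ℤ × ℤ) :
    spaceTimeFourier u τ n = ∫ z, spaceTimeChar τ n z * u z := rfl

theorem MeasureTheory.Integrable.spaceTimeChar_mul {u : ℝ × Torus2 → ℂ} (hu : Integrable u)
    (τ : ℝ) (n : ℤ × ℤ) : Integrable fun z => spaceTimeChar τ n z * u z :=
  hu.bdd_mul (continuous_spaceTimeChar τ n).aestronglyMeasurable
    (Filter.Eventually.of_forall fun z => (norm_spaceTimeChar τ n z).le)

theorem spaceTimeFourier_sub_translate {G : ℝ × Torus2 → ℂ} (hG : Integrable G) (τ : ℝ)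
    (n : ℤ × ℤ) (w : ℝ × ℝ × ℝ) :
    ∫ z, spaceTimeChar τ n z * (G z - G (z - spaceTimeMk w))
      = (1 - Complex.exp (-(Complex.I * (phase (τ, n.1, n.2) w : ℂ)))) * spaceTimeFourier G τ n := by
  have h1 := hG.spaceTimeChar_mul τ n
  have h2 := (hG.comp_sub_right (spaceTimeMk w)).spaceTimeChar_mul τ n
  have h3 : ∫ z, spaceTimeChar τ n z * G (z - spaceTimeMk w)
      = Complex.exp (-(Complex.I * (phase (τ, n.1, n.2) w : ℂ))) * spaceTimeFourier G τ n := by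
    rw [spaceTimeFourier_eq, ← integral_const_mul,
      ← integral_sub_right_eq_self (fun z => Complex.exp _ * (spaceTimeChar τ n z * G z))
        (spaceTimeMk w)]
    congr 1 with z
    rw [← mul_assoc, ← spaceTimeChar_add_mk, sub_add_cancel]
  simp_rw [mul_sub]
  rw [integral_sub h1 h2, h3, ← spaceTimeFourier_eq]
  ring

/-- The singular integral `∫ (G(z) - G(z - w)) |w|^{-3-σ} dw`. -/
noncomputable def fracDifference (σ : ℝ) (G : ℝ × Torus2 → ℂ) (z : ℝ × Torus2) : ℂ :=
  ∫ w, (G z - G (z - spaceTimeMk w)) * (levyKernel σ w : ℂ)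

theorem measurable_difference {G : ℝ × Torus2 → ℂ} (hG : Measurable G) :
    Measurable fun q : (ℝ × Torus2) × (ℝ × ℝ × ℝ) => G q.1 - G (q.1 - spaceTimeMk q.2) :=
  (hG.comp measurable_fst).sub (hG.comp (measurable_fst.sub
    (continuous_spaceTimeMk.measurable.comp measurable_snd)))

theorem enorm_mul_levyKernel (σ : ℝ) (a : ℂ) (w : ℝ × ℝ × ℝ) :
    ‖a * (levyKernel σ w : ℂ)‖ₑ = ‖a‖ₑ * ENNReal.ofReal (levyKernel σ w) := by
  rw [enorm_mul, ← ofReal_norm (levyKernel σ w : ℂ), Complex.norm_real,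
    Real.norm_of_nonneg (levyKernel_nonneg σ w)]

theorem isFracLaplacian_fracDifference {σ : ℝ} {c : ℂ} (hc : c ≠ 0)
    (hsymb : ∀ ξ : ℝ × ℝ × ℝ,
      ∫ w, (1 - Complex.exp (-(Complex.I * (phase ξ w : ℂ)))) * (levyKernel σ w : ℂ)
        = ((spaceTimeNorm ξ ^ σ : ℝ) : ℂ) * c)
    {G : ℝ × Torus2 → ℂ} (hGm : Measurable G) (hG : Integrable G)
    (hfin : ∫⁻ z, ∫⁻ w, ‖G z - G (z - spaceTimeMk w)‖ₑ * ENNReal.ofReal (levyKernel σ w) < ⊤) :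
    IsFracLaplacian σ G fun z => c⁻¹ * fracDifference σ G z := by
  have hm : Measurable fun q : (ℝ × Torus2) × (ℝ × ℝ × ℝ) =>
      (G q.1 - G (q.1 - spaceTimeMk q.2)) * (levyKernel σ q.2 : ℂ) :=
    (measurable_difference hGm).mul ((measurable_levyKernel σ).complex_ofReal.comp measurable_snd)
  have hint : Integrable (fun q : (ℝ × Torus2) × (ℝ × ℝ × ℝ) =>
      (G q.1 - G (q.1 - spaceTimeMk q.2)) * (levyKernel σ q.2 : ℂ)) (volume.prod volume) := by
    refine ⟨hm.aestronglyMeasurable, ?_⟩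
    rw [HasFiniteIntegral, lintegral_prod _ hm.enorm.aemeasurable]
    simp_rw [enorm_mul_levyKernel]
    exact hfin
  refine ⟨hG, (hint.integral_prod_left).const_mul _, fun τ n => ?_⟩
  have hint' : Integrable (Function.uncurry fun (z : ℝ × Torus2) (w : ℝ × ℝ × ℝ) =>
      spaceTimeChar τ n z * ((G z - G (z - spaceTimeMk w)) * (levyKernel σ w : ℂ)))
      (volume.prod volume) :=
    hint.bdd_mul ((continuous_spaceTimeChar τ n).comp continuous_fst).aestronglyMeasurable
      (Filter.Eventually.of_forall fun q => (norm_spaceTimeChar τ n q.1).le)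
  calc spaceTimeFourier (fun z => c⁻¹ * fracDifference σ G z) τ n
      = c⁻¹ * ∫ z, ∫ w, spaceTimeChar τ n z
          * ((G z - G (z - spaceTimeMk w)) * (levyKernel σ w : ℂ)) := by
        rw [spaceTimeFourier_eq, ← integral_const_mul]
        congr 1 with z
        rw [integral_const_mul, fracDifference]
        ring
    _ = c⁻¹ * ∫ w, ∫ z, spaceTimeChar τ n z
          * ((G z - G (z - spaceTimeMk w)) * (levyKernel σ w : ℂ)) := by
        rw [integral_integral_swap hint']
    _ = c⁻¹ * ∫ w, ((1 - Complex.exp (-(Complex.I * (phase (τ, n.1, n.2) w : ℂ))))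
          * (levyKernel σ w : ℂ)) * spaceTimeFourier G τ n := by
        congr 2 with w
        simp_rw [← mul_assoc]
        rw [integral_mul_const, spaceTimeFourier_sub_translate hG]
        ring
    _ = _ := by
        rw [integral_mul_const, hsymb, spaceTimeNorm, Real.sqrt_eq_rpow,
          ← Real.rpow_mul (by positivity), mul_comm _ c, ← mul_assoc, ← mul_assoc,
          inv_mul_cancel₀ hc, one_mul]
        congr 3
        ring

/-! ### Convolution with a finite measure on `L^p` -/

theorem eLpNorm_lintegral_translate_le {p : ℝ≥0∞} (hp : 1 ≤ p) (hp' : p ≠ ⊤)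
    (ν : Measure (ℝ × ℝ × ℝ)) [IsFiniteMeasure ν] {H : ℝ × Torus2 → ℝ≥0∞} (hH : Measurable H) :
    eLpNorm (fun z => ∫⁻ w, H (z - spaceTimeMk w) ∂ν) p volume
      ≤ ν Set.univ * eLpNorm H p volume := by
  have hp0 : p ≠ 0 := (zero_lt_one.trans_le hp).ne'
  have hq1 : 1 ≤ p.toReal := by
    rw [← ENNReal.toReal_one]; exact ENNReal.toReal_mono hp' hp
  have hq0 : 0 < p.toReal := by linarith
  set q := p.toReal with hq
  have hHm : Measurable fun a : (ℝ × Torus2) × (ℝ × ℝ × ℝ) => H (a.1 - spaceTimeMk a.2) :=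
    hH.comp (measurable_fst.sub (continuous_spaceTimeMk.measurable.comp measurable_snd))
  have hjensen : ∀ z, (∫⁻ w, H (z - spaceTimeMk w) ∂ν) ^ q
      ≤ ν Set.univ ^ (q - 1) * ∫⁻ w, H (z - spaceTimeMk w) ^ q ∂ν := by
    intro z
    have hz : Measurable fun w => H (z - spaceTimeMk w) := hHm.comp measurable_prodMk_left
    have h := eLpNorm'_le_eLpNorm'_mul_rpow_measure_univ (μ := ν) one_pos hq1
      (f := fun w => H (z - spaceTimeMk w)) hz.aestronglyMeasurable
    rw [eLpNorm'_eq_lintegral_enorm, eLpNorm'_eq_lintegral_enorm] at h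
    simp only [enorm_eq_self, ENNReal.rpow_one, div_one] at h
    refine (ENNReal.rpow_le_rpow h hq0.le).trans (le_of_eq ?_)
    rw [ENNReal.mul_rpow_of_nonneg _ _ hq0.le, ← ENNReal.rpow_mul, ← ENNReal.rpow_mul,
      one_div_mul_cancel hq0.ne', ENNReal.rpow_one, mul_comm, sub_mul, one_mul,
      one_div_mul_cancel hq0.ne']
  rw [eLpNorm_eq_lintegral_rpow_enorm_toReal hp0 hp', eLpNorm_eq_lintegral_rpow_enorm_toReal hp0 hp']
  simp only [enorm_eq_self]
  rw [← hq]
  have hswap : ∫⁻ z, ∫⁻ w, H (z - spaceTimeMk w) ^ q ∂ν = ν Set.univ * ∫⁻ z, H z ^ q := by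
    rw [lintegral_lintegral_swap (hHm.pow_const q).aemeasurable]
    simp_rw [fun w => lintegral_sub_right_eq_self (μ := (volume : Measure (ℝ × Torus2)))
      (fun z => H z ^ q) (spaceTimeMk w)]
    rw [lintegral_const, mul_comm]
  calc (∫⁻ z, (∫⁻ w, H (z - spaceTimeMk w) ∂ν) ^ q) ^ (1 / q)
      ≤ (∫⁻ z, ν Set.univ ^ (q - 1) * ∫⁻ w, H (z - spaceTimeMk w) ^ q ∂ν) ^ (1 / q) := by
        gcongr with z
        exact hjensen z
    _ = (ν Set.univ ^ q * ∫⁻ z, H z ^ q) ^ (1 / q) := by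
        rw [lintegral_const_mul _ ((hHm.pow_const q).lintegral_prod_right'), hswap, ← mul_assoc]
        congr 2
        by_cases h0 : ν Set.univ = 0
        · rw [h0, mul_zero, ENNReal.zero_rpow_of_pos hq0]
        · nth_rw 2 [← ENNReal.rpow_one (ν Set.univ)]
          rw [← ENNReal.rpow_add _ _ h0 (measure_ne_top ν _), sub_add_cancel]
    _ = _ := by
        rw [ENNReal.mul_rpow_of_nonneg _ _ (by positivity), ← ENNReal.rpow_mul,
          mul_one_div_cancel hq0.ne', ENNReal.rpow_one]

theorem setLIntegral_lt_top_of_eLpNorm_lt_top {α : Type*} [MeasurableSpace α] {μ : Measure α}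
    {p : ℝ≥0∞} (hp : 1 ≤ p) {f : α → ℝ≥0∞} (hf : Measurable f) (h : eLpNorm f p μ < ⊤) {S : Set α}
    (hS : μ S ≠ ⊤) : ∫⁻ z in S, f z ∂μ < ⊤ := by
  have h1 := eLpNorm_le_eLpNorm_mul_rpow_measure_univ (μ := μ.restrict S) hp
    hf.aestronglyMeasurable
  rw [eLpNorm_one_eq_lintegral_enorm] at h1
  simp only [enorm_eq_self] at h1
  refine h1.trans_lt (ENNReal.mul_lt_top ((eLpNorm_restrict_le _ _ _ _).trans_lt h) ?_)
  refine ENNReal.rpow_lt_top_of_nonneg ?_ (by rwa [Measure.restrict_apply_univ])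
  rw [ENNReal.toReal_one]
  rcases eq_or_ne p ⊤ with rfl | hp'
  · simp
  · have : 1 ≤ p.toReal := by
      rw [← ENNReal.toReal_one]; exact ENNReal.toReal_mono hp' hp
    rw [sub_nonneg]
    exact one_div_le_one_div_of_le one_pos this

/-! ### Measurability of the kernels and operators -/

theorem measurable_dampedWaveKernel {χ : ℝ → ℝ} (hχ : ContDiff ℝ ∞ χ)
    (hsupp : tsupport χ ⊆ Set.Icc (-1) 1) :
    Measurable fun q : ℝ × ℝ × Torus2 => dampedWaveKernel χ q.1 q.2.1 q.2.2 := by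
  simp_rw [dampedWaveKernel_eq hsupp]
  have h1 : Measurable (outerCutoff χ) := by
    unfold outerCutoff
    have := hχ.continuous.measurable
    fun_prop
  have h2 : Measurable fun q : ℝ × ℝ × Torus2 => coneProfile (q.1 - q.2.1) (torusAbs q.2.2) :=
    measurable_coneProfile.comp ((measurable_fst.sub (measurable_fst.comp measurable_snd)).prodMk
      (continuous_torusAbs.measurable.comp (measurable_snd.comp measurable_snd)))
  exact (measurable_innerCutoff.comp (measurable_fst.comp measurable_snd)).mul
    ((h1.comp measurable_fst).mul h2)

theorem measurable_japBracket : Measurable japBracket := by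
  unfold japBracket; fun_prop

theorem measurable_majorantKernel (σ : ℝ) :
    Measurable fun q : ℝ × ℝ × Torus2 => majorantKernel σ q.1 q.2.1 q.2.2 := by
  have h1 := measurable_japBracket
  have h2 := continuous_torusAbs.measurable
  unfold majorantKernel
  fun_prop

/-- The point at which convolution kernels are evaluated. -/
noncomputable def kernelArg (q : (ℝ × Torus2) × (ℝ × Torus2)) : ℝ × ℝ × Torus2 :=
  (q.1.1, q.2.1, q.1.2 - q.2.2)

theorem measurable_kernelArg : Measurable kernelArg := by
  unfold kernelArg
  exact (measurable_fst.comp measurable_fst).prodMk ((measurable_fst.comp measurable_snd).prodMk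
    ((measurable_snd.comp measurable_fst).sub (measurable_snd.comp measurable_snd)))

section Operators

variable {χ : ℝ → ℝ} (hχ : ContDiff ℝ ∞ χ) (hsupp : tsupport χ ⊆ Set.Icc (-1) 1) {σ : ℝ}
  {F : ℝ × Torus2 → ℂ} (hF : Measurable F)

include hF in
theorem majorantOperator_eq (σ : ℝ) (z : ℝ × Torus2) :
    majorantOperator σ F z = ENNReal.ofReal (2 * π)⁻¹
      * ∫⁻ w : ℝ × Torus2, ENNReal.ofReal (majorantKernel σ z.1 w.1 (z.2 - w.2)) * ‖F w‖ₑ := by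
  have hm : Measurable fun w : ℝ × Torus2 =>
      ENNReal.ofReal (majorantKernel σ z.1 w.1 (z.2 - w.2)) * ‖F w‖ₑ :=
    (((measurable_majorantKernel σ).comp measurable_kernelArg).comp
      measurable_prodMk_left).ennreal_ofReal.mul hF.enorm
  rw [majorantOperator, lintegral_const_mul' _ _ ENNReal.ofReal_ne_top, Measure.volume_eq_prod ℝ Torus2,
    lintegral_prod _ hm.aemeasurable]

include hF in
theorem measurable_majorantOperator (σ : ℝ) : Measurable (majorantOperator σ F) := by
  rw [funext (majorantOperator_eq hF σ)]
  exact (((measurable_majorantKernel σ).comp measurable_kernelArg).ennreal_ofReal.mul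
    (hF.enorm.comp measurable_snd)).lintegral_prod_right'.const_mul _

include hχ hsupp hF in
theorem measurable_dampedWaveKernel_mul :
    Measurable fun q : (ℝ × Torus2) × (ℝ × Torus2) =>
      (dampedWaveKernel χ q.1.1 q.2.1 (q.1.2 - q.2.2) : ℂ) * F q.2 :=
  ((measurable_dampedWaveKernel hχ hsupp).comp measurable_kernelArg).complex_ofReal.mul
    (hF.comp measurable_snd)

include hχ hsupp hF in
theorem measurable_dampedWaveDuhamel : Measurable (dampedWaveDuhamel χ F) := by
  have hm := measurable_dampedWaveKernel_mul hχ hsupp hF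
  have h1 : StronglyMeasurable fun a : (ℝ × Torus2) × ℝ => ((2 * π)⁻¹ : ℂ)
      * ∫ y : Torus2, (dampedWaveKernel χ a.1.1 a.2 (a.1.2 - y) : ℂ) * F (a.2, y) := by
    refine StronglyMeasurable.const_mul (StronglyMeasurable.integral_prod_right
      (f := fun (a : (ℝ × Torus2) × ℝ) (y : Torus2) =>
        (dampedWaveKernel χ a.1.1 a.2 (a.1.2 - y) : ℂ) * F (a.2, y)) ?_) _
    exact (hm.comp ((measurable_fst.comp measurable_fst).prodMk
      ((measurable_snd.comp measurable_fst).prodMk measurable_snd))).stronglyMeasurable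
  exact (StronglyMeasurable.integral_prod_right
    (f := fun (z : ℝ × Torus2) (s : ℝ) => ((2 * π)⁻¹ : ℂ)
      * ∫ y : Torus2, (dampedWaveKernel χ z.1 s (z.2 - y) : ℂ) * F (s, y)) h1).measurable

/-! ### Bounds for the Duhamel operator by the majorant operator -/

theorem enorm_ofReal_mul (a : ℝ) (b : ℂ) : ‖(a : ℂ) * b‖ₑ = ENNReal.ofReal |a| * ‖b‖ₑ := by
  rw [enorm_mul, ← ofReal_norm (a : ℂ), Complex.norm_real, Real.norm_eq_abs]

theorem enorm_two_pi_inv : ‖((2 * π)⁻¹ : ℂ)‖ₑ = ENNReal.ofReal (2 * π)⁻¹ := by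
  have : ((2 * π)⁻¹ : ℂ) = (((2 * π)⁻¹ : ℝ) : ℂ) := by push_cast; ring
  rw [this, ← ofReal_norm, Complex.norm_real, Real.norm_of_nonneg (by positivity)]

include hF in
theorem lintegral_dampedWaveKernel_mul_le {C : ℝ} (hC : 0 ≤ C)
    (h : ∀ t s x, |dampedWaveKernel χ t s x| ≤ C * majorantKernel σ t s x) (z : ℝ × Torus2) :
    ENNReal.ofReal (2 * π)⁻¹
        * ∫⁻ w : ℝ × Torus2, ‖(dampedWaveKernel χ z.1 w.1 (z.2 - w.2) : ℂ) * F w‖ₑ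
      ≤ ENNReal.ofReal C * majorantOperator σ F z := by
  rw [majorantOperator_eq hF, mul_left_comm,
    ← lintegral_const_mul' (ENNReal.ofReal C) _ ENNReal.ofReal_ne_top]
  refine mul_le_mul_right (lintegral_mono fun w => ?_) _
  rw [enorm_ofReal_mul, ← mul_assoc, ← ENNReal.ofReal_mul hC]
  exact mul_le_mul_left (ENNReal.ofReal_le_ofReal (h _ _ _)) _

include hχ hsupp hF in
theorem enorm_dampedWaveDuhamel_le {C : ℝ} (hC : 0 ≤ C)
    (h : ∀ t s x, |dampedWaveKernel χ t s x| ≤ C * majorantKernel σ t s x) (z : ℝ × Torus2) :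
    ‖dampedWaveDuhamel χ F z‖ₑ ≤ ENNReal.ofReal C * majorantOperator σ F z := by
  have hm := (measurable_dampedWaveKernel_mul hχ hsupp hF).comp (measurable_prodMk_left (x := z))
  refine le_trans ?_ (lintegral_dampedWaveKernel_mul_le hF hC h z)
  rw [Measure.volume_eq_prod ℝ Torus2]
  refine le_trans ?_ (mul_le_mul_right (lintegral_prod _ hm.enorm.aemeasurable).ge _)
  simp only [Function.comp_apply]
  rw [← lintegral_const_mul' _ _ ENNReal.ofReal_ne_top]
  refine (enorm_integral_le_lintegral_enorm _).trans (lintegral_mono fun s => ?_)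
  rw [enorm_mul, enorm_two_pi_inv]
  exact mul_le_mul_right (enorm_integral_le_lintegral_enorm _) _

include hχ hsupp hF in
theorem integrable_dampedWaveKernel_mul {C : ℝ} (hC : 0 ≤ C)
    (h : ∀ t s x, |dampedWaveKernel χ t s x| ≤ C * majorantKernel σ t s x) {z : ℝ × Torus2}
    (hz : majorantOperator σ F z < ⊤) :
    Integrable fun w : ℝ × Torus2 => (dampedWaveKernel χ z.1 w.1 (z.2 - w.2) : ℂ) * F w := by
  refine ⟨((measurable_dampedWaveKernel_mul hχ hsupp hF).comp
    measurable_prodMk_left).aestronglyMeasurable, ?_⟩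
  have h1 := (lintegral_dampedWaveKernel_mul_le hF hC h z).trans_lt
    (ENNReal.mul_lt_top ENNReal.ofReal_lt_top hz)
  refine ENNReal.lt_top_of_mul_ne_top_right h1.ne ?_
  rw [ne_eq, ENNReal.ofReal_eq_zero, not_le]
  positivity

include hχ hsupp hF in
theorem dampedWaveDuhamel_eq {C : ℝ} (hC : 0 ≤ C)
    (h : ∀ t s x, |dampedWaveKernel χ t s x| ≤ C * majorantKernel σ t s x) {z : ℝ × Torus2}
    (hz : majorantOperator σ F z < ⊤) :
    dampedWaveDuhamel χ F z = ((2 * π)⁻¹ : ℂ)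
      * ∫ w : ℝ × Torus2, (dampedWaveKernel χ z.1 w.1 (z.2 - w.2) : ℂ) * F w := by
  have hint := integrable_dampedWaveKernel_mul hχ hsupp hF hC h hz
  rw [Measure.volume_eq_prod ℝ Torus2] at hint ⊢
  rw [dampedWaveDuhamel, integral_const_mul, integral_prod _ hint]

include hsupp in
theorem dampedWaveDuhamel_of_notMem_Icc {z : ℝ × Torus2} (hz : z.1 ∉ Set.Icc (-1 : ℝ) 1) :
    dampedWaveDuhamel χ F z = 0 := by
  simp [dampedWaveDuhamel, dampedWaveKernel_eq hsupp, outerCutoff_of_notMem_Icc hsupp hz]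

theorem ae_torusAbs_sub_pos_and_ne (z : ℝ × Torus2) :
    ∀ᵐ w : ℝ × Torus2, 0 < torusAbs (z.2 - w.2) ∧ |z.1 - w.1| ≠ torusAbs (z.2 - w.2) := by
  have hm : Measurable fun w : ℝ × Torus2 => torusAbs (z.2 - w.2) :=
    continuous_torusAbs.measurable.comp (measurable_const.sub measurable_snd)
  have hm' : Measurable fun w : ℝ × Torus2 => |z.1 - w.1| := by fun_prop
  have hmeas : MeasurableSet {w : ℝ × Torus2 |
      0 < torusAbs (z.2 - w.2) ∧ |z.1 - w.1| ≠ torusAbs (z.2 - w.2)} :=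
    (measurableSet_lt measurable_const hm).inter (measurableSet_eq_fun hm' hm).compl
  rw [ae_iff]
  change (volume : Measure (ℝ × Torus2)) {w : ℝ × Torus2 |
      0 < torusAbs (z.2 - w.2) ∧ |z.1 - w.1| ≠ torusAbs (z.2 - w.2)}ᶜ = 0
  rw [Measure.volume_eq_prod ℝ Torus2, Measure.prod_apply_symm hmeas.compl, lintegral_eq_zero_iff
    (measurable_measure_prodMk_right hmeas.compl)]
  have hx : ∀ᵐ y : Torus2, 0 < torusAbs (z.2 - y) := by
    rw [ae_iff]
    refine measure_mono_null (t := Metric.closedBall z.2.1 0 ×ˢ Set.univ) (fun y hy => ?_) ?_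
    · have h1 := norm_fst_le_torusAbs (z.2 - y)
      rw [Set.mem_ofPred_eq, not_lt] at hy
      refine ⟨?_, trivial⟩
      rw [Metric.mem_closedBall, dist_comm, dist_eq_norm]
      exact h1.trans hy
    · rw [Measure.volume_eq_prod, Measure.prod_prod, AddCircle.volume_closedBall]
      simp [Real.two_pi_pos.le]
  filter_upwards [hx] with y hy
  refine measure_mono_null (t := {z.1 - torusAbs (z.2 - y), z.1 + torusAbs (z.2 - y)})
    (fun s hs => ?_) (Set.Finite.measure_zero (Set.toFinite _) _)
  have hs' : ¬ (0 < torusAbs (z.2 - y) ∧ |z.1 - s| ≠ torusAbs (z.2 - y)) := hs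
  rw [not_and, not_not] at hs'
  rcases abs_choice (z.1 - s) with h | h <;> rw [hs' hy] at h
  · left; linarith
  · right; rw [Set.mem_singleton_iff]; linarith

include hχ hsupp hF in
theorem ae_lintegral_sub_translate_le {C C' : ℝ} (hC : 0 ≤ C) (hC' : 0 ≤ C')
    (h : ∀ t s x, |dampedWaveKernel χ t s x| ≤ C * majorantKernel σ t s x)
    (h' : ∀ (t s : ℝ) (x : Torus2), 0 < torusAbs x → |t - s| ≠ torusAbs x →
      ∫⁻ w in {w : ℝ × ℝ × ℝ | ‖w‖ < 1},
          ENNReal.ofReal (|dampedWaveKernel χ t s x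
            - dampedWaveKernel χ (t - w.1) s (x - torusMk w.2)| * levyKernel σ w)
        ≤ ENNReal.ofReal (C' * majorantKernel σ t s x))
    (hae : ∀ᵐ z, majorantOperator σ F z < ⊤) :
    ∀ᵐ z, ∫⁻ w in {w : ℝ × ℝ × ℝ | ‖w‖ < 1},
        ‖dampedWaveDuhamel χ F z - dampedWaveDuhamel χ F (z - spaceTimeMk w)‖ₑ
          * ENNReal.ofReal (levyKernel σ w)
      ≤ ENNReal.ofReal C' * majorantOperator σ F z := by
  have hAm := measurable_majorantOperator hF σ
  have hsubm : Measurable fun q : (ℝ × Torus2) × (ℝ × ℝ × ℝ) => q.1 - spaceTimeMk q.2 :=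
    measurable_fst.sub (continuous_spaceTimeMk.measurable.comp measurable_snd)
  have hae2 : ∀ᵐ z : ℝ × Torus2, ∀ᵐ w : ℝ × ℝ × ℝ,
      majorantOperator σ F (z - spaceTimeMk w) < ⊤ := by
    rw [Measure.ae_ae_comm (p := fun z w => majorantOperator σ F (z - spaceTimeMk w) < ⊤)
      (measurableSet_lt (hAm.comp hsubm) measurable_const)]
    exact Filter.Eventually.of_forall fun w =>
      (measurePreserving_sub_right (volume : Measure (ℝ × Torus2))
        (spaceTimeMk w)).quasiMeasurePreserving.ae hae
  filter_upwards [hae, hae2] with z hz hz2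
  set D : Set (ℝ × ℝ × ℝ) := {w | ‖w‖ < 1} with hD
  have hDm : MeasurableSet D := measurableSet_lt (by fun_prop) measurable_const
  let K : (ℝ × ℝ × ℝ) → (ℝ × Torus2) → ℝ := fun w w' =>
    |dampedWaveKernel χ z.1 w'.1 (z.2 - w'.2)
      - dampedWaveKernel χ (z.1 - w.1) w'.1 (z.2 - w'.2 - torusMk w.2)|
  have hKm : Measurable (Function.uncurry K) := by
    have h1 := measurable_dampedWaveKernel hχ hsupp
    have e2 : Measurable fun q : (ℝ × ℝ × ℝ) × (ℝ × Torus2) =>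
        ((z.1, q.2.1, z.2 - q.2.2) : ℝ × ℝ × Torus2) :=
      measurable_const.prodMk ((measurable_fst.comp measurable_snd).prodMk
        (measurable_const.sub (measurable_snd.comp measurable_snd)))
    have e3 : Measurable fun q : (ℝ × ℝ × ℝ) × (ℝ × Torus2) =>
        ((z.1 - q.1.1, q.2.1, z.2 - q.2.2 - torusMk q.1.2) : ℝ × ℝ × Torus2) :=
      (measurable_const.sub (measurable_fst.comp measurable_fst)).prodMk
        ((measurable_fst.comp measurable_snd).prodMk
        ((measurable_const.sub (measurable_snd.comp measurable_snd)).sub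
          (continuous_torusMk.measurable.comp (measurable_snd.comp measurable_fst))))
    have h2 := h1.comp e2
    have h3 := h1.comp e3
    exact (h2.sub h3).norm
  have hpt : ∀ᵐ w : ℝ × ℝ × ℝ,
      ‖dampedWaveDuhamel χ F z - dampedWaveDuhamel χ F (z - spaceTimeMk w)‖ₑ
          * ENNReal.ofReal (levyKernel σ w)
        ≤ ENNReal.ofReal (2 * π)⁻¹
          * ∫⁻ w', ENNReal.ofReal (K w w' * levyKernel σ w) * ‖F w'‖ₑ := by
    filter_upwards [hz2] with w hw
    rw [dampedWaveDuhamel_eq hχ hsupp hF hC h hz, dampedWaveDuhamel_eq hχ hsupp hF hC h hw,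
      ← mul_sub, ← integral_sub (integrable_dampedWaveKernel_mul hχ hsupp hF hC h hz)
        (integrable_dampedWaveKernel_mul hχ hsupp hF hC h hw), enorm_mul, enorm_two_pi_inv,
      mul_assoc]
    refine mul_le_mul_right ?_ _
    refine (mul_le_mul_left (enorm_integral_le_lintegral_enorm _) _).trans (le_of_eq ?_)
    rw [← lintegral_mul_const' _ _ ENNReal.ofReal_ne_top]
    congr 1 with w'
    rw [← sub_mul, ← Complex.ofReal_sub, enorm_ofReal_mul, ENNReal.ofReal_mul (abs_nonneg _),
      mul_right_comm]
    simp only [spaceTimeMk, Prod.fst_sub, Prod.snd_sub, sub_right_comm z.2 _ (torusMk w.2)]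
  have hKm' : Measurable (Function.uncurry fun w w' =>
      ENNReal.ofReal (K w w' * levyKernel σ w) * ‖F w'‖ₑ) :=
    (hKm.mul ((measurable_levyKernel σ).comp measurable_fst)).ennreal_ofReal.mul
      (hF.enorm.comp measurable_snd)
  calc _ ≤ ∫⁻ w in D, ENNReal.ofReal (2 * π)⁻¹
          * ∫⁻ w', ENNReal.ofReal (K w w' * levyKernel σ w) * ‖F w'‖ₑ :=
        lintegral_mono_ae (ae_restrict_of_ae hpt)
    _ = ENNReal.ofReal (2 * π)⁻¹
          * ∫⁻ w', ∫⁻ w in D, ENNReal.ofReal (K w w' * levyKernel σ w) * ‖F w'‖ₑ := by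
        rw [lintegral_const_mul' _ _ ENNReal.ofReal_ne_top,
          lintegral_lintegral_swap hKm'.aemeasurable]
    _ ≤ ENNReal.ofReal (2 * π)⁻¹ * ∫⁻ w' : ℝ × Torus2, ENNReal.ofReal C'
          * (ENNReal.ofReal (majorantKernel σ z.1 w'.1 (z.2 - w'.2)) * ‖F w'‖ₑ) := by
        refine mul_le_mul_right (lintegral_mono_ae ?_) _
        filter_upwards [ae_torusAbs_sub_pos_and_ne z] with w' hw'
        rw [lintegral_mul_const' _ _ enorm_ne_top, ← mul_assoc, ← ENNReal.ofReal_mul hC']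
        exact mul_le_mul_left (h' _ _ _ hw'.1 hw'.2) _
    _ = _ := by
        rw [majorantOperator_eq hF, lintegral_const_mul' _ _ ENNReal.ofReal_ne_top, mul_left_comm]

end Operators

theorem dampedWaveDuhamel_congr {χ : ℝ → ℝ} {F F' : ℝ × Torus2 → ℂ} (h : F =ᵐ[volume] F') :
    dampedWaveDuhamel χ F = dampedWaveDuhamel χ F' := by
  ext z
  refine integral_congr_ae ?_
  filter_upwards [Measure.ae_ae_of_ae_prod h] with s hs
  rw [integral_congr_ae]
  filter_upwards [hs] with y hy
  rw [hy]

theorem majorantOperator_congr {σ : ℝ} {F F' : ℝ × Torus2 → ℂ} (h : F =ᵐ[volume] F') :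
    majorantOperator σ F = majorantOperator σ F' := by
  ext z
  refine lintegral_congr_ae ?_
  filter_upwards [Measure.ae_ae_of_ae_prod h] with s hs
  rw [lintegral_congr_ae]
  filter_upwards [hs] with y hy
  rw [hy]

theorem volume_slab_ne_top (a b : ℝ) :
    (volume : Measure (ℝ × Torus2)) (Set.Icc a b ×ˢ Set.univ) ≠ ⊤ := by
  rw [Measure.volume_eq_prod ℝ Torus2, Measure.prod_prod, Measure.volume_eq_prod, ← Set.univ_prod_univ,
    Measure.prod_prod]
  exact ENNReal.mul_ne_top (by simp) (ENNReal.mul_ne_top (measure_ne_top _ _) (measure_ne_top _ _))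

theorem lintegral_lt_top_of_le_on_slab {p : ℝ≥0∞} (hp : 1 ≤ p) {A f : ℝ × Torus2 → ℝ≥0∞}
    (hA : Measurable A) (hAp : eLpNorm A p volume < ⊤) {C : ℝ≥0∞} (hC : C ≠ ⊤)
    (hf : ∀ᵐ z, f z ≤ C * A z) (a b : ℝ) (hf0 : ∀ z : ℝ × Torus2, z.1 ∉ Set.Icc a b → f z = 0) :
    ∫⁻ z, f z < ⊤ := by
  have hS : MeasurableSet (Set.Icc a b ×ˢ Set.univ : Set (ℝ × Torus2)) :=
    measurableSet_Icc.prod MeasurableSet.univ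
  have h1 : ∫⁻ z, f z = ∫⁻ z in Set.Icc a b ×ˢ Set.univ, f z := by
    rw [← lintegral_indicator hS]
    congr 1 with z
    by_cases hz : z ∈ (Set.Icc a b ×ˢ Set.univ : Set (ℝ × Torus2))
    · rw [Set.indicator_of_mem hz]
    · rw [Set.indicator_of_notMem hz]
      exact hf0 z fun h => hz ⟨h, trivial⟩
  calc ∫⁻ z, f z = ∫⁻ z in Set.Icc a b ×ˢ Set.univ, f z := h1
    _ ≤ ∫⁻ z in Set.Icc a b ×ˢ Set.univ, C * A z := lintegral_mono_ae (ae_restrict_of_ae hf)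
    _ = C * ∫⁻ z in Set.Icc a b ×ˢ Set.univ, A z := lintegral_const_mul' _ _ hC
    _ < ⊤ := ENNReal.mul_lt_top hC.lt_top
      (setLIntegral_lt_top_of_eLpNorm_lt_top hp hA hAp (volume_slab_ne_top a b))

theorem ae_lt_top_of_eLpNorm_lt_top {p : ℝ≥0∞} (hp : 1 ≤ p) (hp' : p ≠ ⊤)
    {A : ℝ × Torus2 → ℝ≥0∞} (hA : Measurable A) (hAp : eLpNorm A p volume < ⊤) :
    ∀ᵐ z, A z < ⊤ := by
  have hp0 : p ≠ 0 := (zero_lt_one.trans_le hp).ne'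
  have h := (eLpNorm_lt_top_iff_lintegral_rpow_enorm_lt_top hp0 hp').1 hAp
  simp only [enorm_eq_self] at h
  filter_upwards [ae_lt_top (hA.pow_const _) h.ne] with z hz
  exact (ENNReal.rpow_lt_top_iff_of_pos (ENNReal.toReal_pos hp0 hp')).1 hz

/-- The part of the Lévy measure of `(-Δ)^{σ/2}` away from the origin. -/
noncomputable def farLevyMeasure (σ : ℝ) : Measure (ℝ × ℝ × ℝ) :=
  (volume.restrict {w : ℝ × ℝ × ℝ | ‖w‖ < 1}ᶜ).withDensity
    fun w => ENNReal.ofReal (levyKernel σ w)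

theorem isFiniteMeasure_farLevyMeasure {σ : ℝ} (hσ : 0 < σ) (hσ' : σ < 1) :
    IsFiniteMeasure (farLevyMeasure σ) :=
  isFiniteMeasure_withDensity (setLIntegral_levyKernel_lt_top hσ hσ').ne

theorem lintegral_difference_le (σ : ℝ) {G : ℝ × Torus2 → ℂ} (hG : Measurable G)
    (z : ℝ × Torus2) :
    ∫⁻ w, ‖G z - G (z - spaceTimeMk w)‖ₑ * ENNReal.ofReal (levyKernel σ w)
      ≤ (∫⁻ w in {w : ℝ × ℝ × ℝ | ‖w‖ < 1},
          ‖G z - G (z - spaceTimeMk w)‖ₑ * ENNReal.ofReal (levyKernel σ w))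
        + (farLevyMeasure σ Set.univ * ‖G z‖ₑ
          + ∫⁻ w, ‖G (z - spaceTimeMk w)‖ₑ ∂(farLevyMeasure σ)) := by
  have hDm : MeasurableSet {w : ℝ × ℝ × ℝ | ‖w‖ < 1} :=
    measurableSet_lt (by fun_prop) measurable_const
  have hJ := (measurable_levyKernel σ).ennreal_ofReal
  have hGz : Measurable fun w => ‖G (z - spaceTimeMk w)‖ₑ :=
    (hG.comp (measurable_const.sub continuous_spaceTimeMk.measurable)).enorm
  rw [← lintegral_add_compl _ hDm]
  gcongr
  rw [farLevyMeasure, lintegral_withDensity_eq_lintegral_mul _ hJ hGz, withDensity_apply _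
    MeasurableSet.univ, Measure.restrict_univ, ← lintegral_mul_const _ hJ,
    ← lintegral_add_left (hJ.mul_const _)]
  refine lintegral_mono fun w => ?_
  rw [Pi.mul_apply, ← mul_add, mul_comm]
  gcongr
  exact enorm_sub_le

theorem proposition3p1
    (χ : ℝ → ℝ) (hχ_smooth : ContDiff ℝ ∞ χ)
    (hχ_one : ∀ t ∈ Set.Icc (-(3 / 4) : ℝ) (3 / 4), χ t = 1)
    (hχ_supp : tsupport χ ⊆ Set.Icc (-1) 1)
    (p : ℝ≥0∞) (hp_one : 1 ≤ p) (hp_top : p ≠ ⊤)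
    (σ : ℝ) (hσ_nonneg : 0 ≤ σ) (hσ_lt : σ < 1 / 2) :
    ∃ C : ℝ≥0, ∀ F : ℝ × Torus2 → ℂ, AEStronglyMeasurable F volume →
      eLpNorm (majorantOperator σ F) p volume < ⊤ →
        (∀ᵐ z : ℝ × Torus2 ∂volume, Integrable
          (fun w : ℝ × Torus2 => (dampedWaveKernel χ z.1 w.1 (z.2 - w.2) : ℂ) * F w) volume) ∧
        ∃ g : ℝ × Torus2 → ℂ,
          IsFracLaplacian σ (dampedWaveDuhamel χ F) g ∧
          eLpNorm g p volume ≤ C * eLpNorm (majorantOperator σ F) p volume := by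
  suffices H : ∃ C : ℝ≥0, ∀ F : ℝ × Torus2 → ℂ, Measurable F →
      eLpNorm (majorantOperator σ F) p volume < ⊤ →
        (∀ᵐ z : ℝ × Torus2 ∂volume, Integrable
          (fun w : ℝ × Torus2 => (dampedWaveKernel χ z.1 w.1 (z.2 - w.2) : ℂ) * F w) volume) ∧
        ∃ g : ℝ × Torus2 → ℂ,
          IsFracLaplacian σ (dampedWaveDuhamel χ F) g ∧
          eLpNorm g p volume ≤ C * eLpNorm (majorantOperator σ F) p volume by
    obtain ⟨C, hC⟩ := H
    refine ⟨C, fun F hF hFp => ?_⟩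
    rw [majorantOperator_congr hF.ae_eq_mk] at hFp ⊢
    rw [dampedWaveDuhamel_congr hF.ae_eq_mk]
    obtain ⟨h1, h2⟩ := hC _ hF.stronglyMeasurable_mk.measurable hFp
    refine ⟨h1.mono fun z hz => hz.congr ?_, h2⟩
    filter_upwards [hF.ae_eq_mk] with w hw
    rw [hw]
  obtain ⟨C₁, hC₁, hK⟩ := exists_abs_dampedWaveKernel_le hχ_smooth hχ_supp hσ_nonneg hσ_lt
  have hGint : ∀ F : ℝ × Torus2 → ℂ, Measurable F →
      eLpNorm (majorantOperator σ F) p volume < ⊤ → Integrable (dampedWaveDuhamel χ F) :=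
    fun F hF hFp => ⟨(measurable_dampedWaveDuhamel hχ_smooth hχ_supp hF).aestronglyMeasurable,
      lintegral_lt_top_of_le_on_slab hp_one (measurable_majorantOperator hF σ) hFp
        ENNReal.ofReal_ne_top (Filter.Eventually.of_forall
          (enorm_dampedWaveDuhamel_le hχ_smooth hχ_supp hF hC₁ hK)) (-1) 1 fun z hz => by
            rw [dampedWaveDuhamel_of_notMem_Icc hχ_supp hz, enorm_zero]⟩
  have hGp : ∀ F : ℝ × Torus2 → ℂ, Measurable F →
      eLpNorm (dampedWaveDuhamel χ F) p volume
        ≤ ENNReal.ofReal C₁ * eLpNorm (majorantOperator σ F) p volume := fun F hF => by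
    exact eLpNorm_le_nnreal_smul_eLpNorm_of_ae_le_mul' (Filter.Eventually.of_forall
      (enorm_dampedWaveDuhamel_le hχ_smooth hχ_supp hF hC₁ hK)) p
  rcases hσ_nonneg.eq_or_lt with rfl | hσ
  · refine ⟨C₁.toNNReal, fun F hF hFp => ⟨?_, dampedWaveDuhamel χ F,
      ⟨hGint F hF hFp, hGint F hF hFp, fun τ n => by simp⟩, hGp F hF⟩⟩
    exact (ae_lt_top_of_eLpNorm_lt_top hp_one hp_top (measurable_majorantOperator hF 0) hFp).mono
      fun z hz => integrable_dampedWaveKernel_mul hχ_smooth hχ_supp hF hC₁ hK hz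
  obtain ⟨C₂, hC₂, hD⟩ := exists_lintegral_dampedWaveKernel_sub_le hχ_smooth hχ_supp hσ hσ_lt
  have hσ1 : σ < 1 := by linarith
  obtain ⟨c, hc, hsymb⟩ := exists_levy_symbol hσ hσ1
  have := isFiniteMeasure_farLevyMeasure hσ hσ1
  set m : ℝ≥0 := (farLevyMeasure σ Set.univ).toNNReal with hmdef
  have hm : farLevyMeasure σ Set.univ = m := (ENNReal.coe_toNNReal (measure_ne_top _ _)).symm
  refine ⟨‖c⁻¹‖₊ * (C₂.toNNReal + m * C₁.toNNReal + m * C₁.toNNReal), fun F hF hFp => ?_⟩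
  set A := majorantOperator σ F with hA
  set G := dampedWaveDuhamel χ F with hG
  have hAm : Measurable A := measurable_majorantOperator hF σ
  have hGm : Measurable G := measurable_dampedWaveDuhamel hχ_smooth hχ_supp hF
  have hAfin : ∀ᵐ z, A z < ⊤ := ae_lt_top_of_eLpNorm_lt_top hp_one hp_top hAm hFp
  have hGA : ∀ z, ‖G z‖ₑ ≤ ENNReal.ofReal C₁ * A z :=
    enorm_dampedWaveDuhamel_le hχ_smooth hχ_supp hF hC₁ hK
  set N : ℝ × Torus2 → ℝ≥0∞ := fun z => ∫⁻ w in {w : ℝ × ℝ × ℝ | ‖w‖ < 1},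
    ‖G z - G (z - spaceTimeMk w)‖ₑ * ENNReal.ofReal (levyKernel σ w) with hN
  set V : ℝ × Torus2 → ℝ≥0∞ := fun z =>
    ∫⁻ w, ‖G (z - spaceTimeMk w)‖ₑ ∂(farLevyMeasure σ) with hV
  have hNA : ∀ᵐ z, N z ≤ ENNReal.ofReal C₂ * A z :=
    ae_lintegral_sub_translate_le hχ_smooth hχ_supp hF hC₁ hC₂ hK hD hAfin
  have hVm : Measurable V :=
    Measurable.lintegral_prod_right' (f := fun q : (ℝ × Torus2) × (ℝ × ℝ × ℝ) =>
      ‖G (q.1 - spaceTimeMk q.2)‖ₑ) (hGm.comp (measurable_fst.sub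
        (continuous_spaceTimeMk.measurable.comp measurable_snd))).enorm
  have hVp : ∀ q : ℝ≥0∞, 1 ≤ q → q ≠ ⊤ → eLpNorm V q volume ≤ m * eLpNorm G q volume :=
    fun q hq hq' => by
      have h := eLpNorm_lintegral_translate_le hq hq' (farLevyMeasure σ) hGm.enorm
      rwa [hm, eLpNorm_enorm] at h
  have hNint : ∫⁻ z, N z < ⊤ := by
    refine lintegral_lt_top_of_le_on_slab hp_one hAm hFp ENNReal.ofReal_ne_top hNA (-2) 2
      fun z hz => ?_
    have hDm : MeasurableSet {w : ℝ × ℝ × ℝ | ‖w‖ < 1} :=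
      measurableSet_lt (by fun_prop) measurable_const
    simp only [hN]
    rw [setLIntegral_congr_fun (g := fun _ => 0) hDm, lintegral_zero]
    intro w hw
    have hw1 := abs_lt.1 ((abs_fst_le_norm w).trans_lt hw)
    have e1 : G z = 0 := dampedWaveDuhamel_of_notMem_Icc hχ_supp fun h =>
      hz ⟨by linarith [h.1], by linarith [h.2]⟩
    have e2 : G (z - spaceTimeMk w) = 0 := dampedWaveDuhamel_of_notMem_Icc hχ_supp fun h => by
      simp only [spaceTimeMk, Prod.fst_sub] at h
      exact hz ⟨by linarith [h.1], by linarith [h.2]⟩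
    simp [e1, e2]
  have hGi : Integrable G := hGint F hF hFp
  have hVint : ∫⁻ z, V z < ⊤ := by
    have h := hVp 1 le_rfl ENNReal.one_ne_top
    rw [eLpNorm_one_eq_lintegral_enorm, eLpNorm_one_eq_lintegral_enorm] at h
    simp only [enorm_eq_self] at h
    exact h.trans_lt (ENNReal.mul_lt_top ENNReal.coe_lt_top hGi.2)
  refine ⟨hAfin.mono fun z hz =>
    integrable_dampedWaveKernel_mul hχ_smooth hχ_supp hF hC₁ hK hz,
    fun z => c⁻¹ * fracDifference σ G z,
    isFracLaplacian_fracDifference hc hsymb hGm hGi ?_, ?_⟩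
  · refine (lintegral_mono (lintegral_difference_le σ hGm)).trans_lt ?_
    have hr : Measurable fun z => (m : ℝ≥0∞) * ‖G z‖ₑ + V z := (hGm.enorm.const_mul _).add hVm
    rw [hm, lintegral_add_right _ hr, lintegral_add_right _ hVm, lintegral_const_mul' _ _ ENNReal.coe_ne_top]
    exact ENNReal.add_lt_top.2 ⟨hNint, ENNReal.add_lt_top.2
      ⟨ENNReal.mul_lt_top ENNReal.coe_lt_top hGi.2, hVint⟩⟩
  · have hpt : ∀ᵐ z, ‖c⁻¹ * fracDifference σ G z‖ₑ ≤ (‖c⁻¹‖₊ : ℝ≥0∞)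
        * ‖((fun z => ((C₂.toNNReal + m * C₁.toNNReal : ℝ≥0) : ℝ≥0∞) * A z) + V) z‖ₑ := by
      filter_upwards [hNA] with z hz
      rw [enorm_mul, enorm_eq_self, Pi.add_apply]
      refine mul_le_mul_right ?_ _
      refine (enorm_integral_le_lintegral_enorm _).trans ?_
      simp_rw [enorm_mul_levyKernel]
      refine (lintegral_difference_le σ hGm z).trans ?_
      rw [hm, ← add_assoc, ENNReal.coe_add, ENNReal.coe_mul, add_mul, mul_assoc]
      exact add_le_add_left (add_le_add hz (mul_le_mul_right (hGA z) _)) _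
    refine (eLpNorm_le_nnreal_smul_eLpNorm_of_ae_le_mul' hpt p).trans ?_
    rw [ENNReal.smul_def, smul_eq_mul, ENNReal.coe_mul, mul_assoc]
    refine mul_le_mul_right ?_ _
    refine (eLpNorm_add_le (hAm.const_mul _).aestronglyMeasurable hVm.aestronglyMeasurable
      hp_one).trans ?_
    rw [ENNReal.coe_add (_ + _), add_mul]
    refine add_le_add ?_ ?_
    · exact eLpNorm_le_nnreal_smul_eLpNorm_of_ae_le_mul'
        (Filter.Eventually.of_forall fun z => le_rfl) p
    · rw [ENNReal.coe_mul, mul_assoc]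
      exact (hVp p hp_one hp_top).trans (mul_le_mul_right (hGp F hF) _)
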